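/- Let $N$ be a finite-dimensional smooth Hausdorff manifold, with or without boundary (corners are allowed as well), and let $\Theta:\mathbb{R}\times N\to N$ be a smooth action of the group $(\mathbb{R},+)$ on $N$ that is proper, i.e. the shear map $\mathbb{R}\times N\to N\times N$, $(s,p)\mapsto (p,\Theta(s,p))$ is a proper map. Let $\Omega^\bullet(N)$ be the de Rham complex of smooth real differential forms, $\Omega^\bullet_{\mathrm c}(N)$ the subcomplex of compactly supported forms, and $j:\Omega^\bullet_{\mathrm c}(N)\to\Omega^\bullet(N)$ the inclusion. Let $[\Omega^\bullet_{\mathrm c}(N),\Omega^\bullet(N)]$ be the internal hom complex, whose elements of degree $n$ are the families of linear maps $L:\Omega^k_{\mathrm c}(N)\to\Omega^{k+n}(N)$, with differential $\partial L=\mathrm{d}\circ L-(-1)^{n}L\circ\mathrm{d}$. For $S\subseteq N$ put $$J^{\uparrow}_\Theta(S)=\{\Theta(s,p): p\in S,\ s\ge 0\},\qquad J^{\downarrow}_\Theta(S)=\{\Theta(s,p): p\in S,\ s\le 0\}.$$ A forward (respectively backward) Green's homotopy is an element $G\in[\Omega^\bullet_{\mathrm c}(N),\Omega^\bullet(N)]^{-1}$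 such that (i) $\partial G=j$, i.e. $\mathrm{d}\,G+G\,\mathrm{d}=j$, and (ii) $\operatorname{supp}(G\alpha)\subseteq J^{\uparrow}_\Theta(\operatorname{supp}\alpha)$ (respectively $\operatorname{supp}(G\alpha)\subseteq J^{\downarrow}_\Theta(\operatorname{supp}\alpha)$) for all $\alpha\in\Omega^\bullet_{\mathrm c}(N)$. Then the maps $$G^{\uparrow}_\Theta=\int_{\mathbb{R}^{\le 0}}\Theta^*,\qquad G^{\downarrow}_\Theta=-\int_{\mathbb{R}^{\ge 0}}\Theta^*,$$ where $\int$ is integration along the fibers of the projection $\mathbb{R}\times N\to N$ in the fiber-first convention, that is, for $\alpha\in\Omega^{k+1}_{\mathrm c}(N)$, $p\in N$ and $v_1,\dots,v_k\in T_pN$, $$(G^{\uparrow}_\Theta\alpha)_p(v_1,\dots,v_k)=\int_{-\infty}^0(\Theta^*\alpha)_{(s,p)}(\partial_s,v_1,\dots,v_k)\,\mathrm{d}s,\qquad (G^{\downarrow}_\Theta\alpha)_p(v_1,\dots,v_k)=-\int_0^{\infty}(\Theta^*\alpha)_{(s,p)}(\partial_s,v_1,\dots,v_k)\,\mathrm{d}s,$$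 are well-defined elements of $[\Omega^\bullet_{\mathrm c}(N),\Omega^\bullet(N)]^{-1}$ (the integrals converge and define smooth forms), $G^{\uparrow}_\Theta$ is a forward Green's homotopy, and $G^{\downarrow}_\Theta$ is a backward Green's homotopy. -/

import Mathlib

open scoped Manifold ContDiff Topology

noncomputable section

namespace GreenHomotopy

/-! ### Smoothness of the pullback of alternating forms along linear maps -/

section Pullback

variable {E F : Type*} [NormedAddCommGroup E] [NormedSpace ℝ E]
  [NormedAddCommGroup F] [NormedSpace ℝ F]

theorem exists_leftInverse_toContinuousMultilinearMap (k : ℕ) :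
    ∃ L : ContinuousMultilinearMap ℝ (fun _ : Fin k ↦ E) ℝ →L[ℝ] (E [⋀^Fin k]→L[ℝ] ℝ),
      ∀ f : E [⋀^Fin k]→L[ℝ] ℝ, L f.toContinuousMultilinearMap = f := by
  classical
  let A : ContinuousMultilinearMap ℝ (fun _ : Fin k ↦ E) ℝ →ₗ[ℝ] (E [⋀^Fin k]→L[ℝ] ℝ) :=
    { toFun := fun f ↦ ((k.factorial : ℝ)⁻¹) • ContinuousMultilinearMap.alternatization f
      map_add' := by intro f g; simp
      map_smul' := by
        intro c f
        have h : ContinuousMultilinearMap.alternatization (c • f) =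
            c • ContinuousMultilinearMap.alternatization f := by
          ext v
          rw [ContinuousAlternatingMap.smul_apply,
            ContinuousMultilinearMap.alternatization_apply_apply,
            ContinuousMultilinearMap.alternatization_apply_apply, Finset.smul_sum]
          exact Finset.sum_congr rfl fun σ _ ↦ smul_comm _ _ _
        rw [h, smul_comm, RingHom.id_apply] }
  refine ⟨A.mkContinuous ((k.factorial : ℝ)⁻¹ * ((Fintype.card (Equiv.Perm (Fin k)) : ℕ) : ℝ)) ?_, ?_⟩
  · intro f
    refine ContinuousAlternatingMap.opNorm_le_bound _ (by positivity) fun v ↦ ?_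
    have h1 : A f v = (k.factorial : ℝ)⁻¹ * ∑ σ : Equiv.Perm (Fin k),
        Equiv.Perm.sign σ • f (v ∘ σ) := by
      simp [A, ContinuousMultilinearMap.alternatization_apply_apply]
    have h2 : ∀ σ : Equiv.Perm (Fin k), ‖Equiv.Perm.sign σ • f (v ∘ σ)‖ ≤ ‖f‖ * ∏ i, ‖v i‖ := by
      intro σ
      have h3 : ‖Equiv.Perm.sign σ • f (v ∘ σ)‖ = ‖f (v ∘ σ)‖ := by
        rcases Int.units_eq_one_or (Equiv.Perm.sign σ) with h | h <;> simp [h]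
      rw [h3]
      refine (f.le_opNorm _).trans_eq ?_
      congr 1
      exact Equiv.prod_comp σ (fun i ↦ ‖v i‖)
    rw [h1, norm_mul]
    have h4 := norm_sum_le_of_le Finset.univ (fun σ _ ↦ h2 σ)
    rw [Finset.sum_const, nsmul_eq_mul] at h4
    have h5 : ‖((k.factorial : ℝ)⁻¹)‖ = (k.factorial : ℝ)⁻¹ := by
      rw [Real.norm_of_nonneg (by positivity)]
    rw [h5, mul_assoc, mul_assoc]
    exact mul_le_mul_of_nonneg_left h4 (by positivity)
  · intro f
    ext v
    have h1 : ∀ σ : Equiv.Perm (Fin k), Equiv.Perm.sign σ • f (v ∘ σ) = f v := by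
      intro σ
      have := f.toAlternatingMap.map_perm v σ
      have h2 : f (v ∘ σ) = Equiv.Perm.sign σ • f v := this
      rw [h2, smul_smul]
      simp
    simp only [LinearMap.mkContinuous_apply]
    show (k.factorial : ℝ)⁻¹ • (ContinuousMultilinearMap.alternatization
      f.toContinuousMultilinearMap) v = f v
    rw [ContinuousMultilinearMap.alternatization_apply_apply]
    simp only [ContinuousAlternatingMap.coe_toContinuousMultilinearMap, h1]
    simp [Fintype.card_perm, Nat.factorial_ne_zero]

theorem contDiff_compContinuousLinearMap (k : ℕ) : ContDiff ℝ ∞ fun p : (F [⋀^Fin k]→L[ℝ] ℝ) × (E →L[ℝ] F) ↦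
    p.1.compContinuousLinearMap p.2 := by
  obtain ⟨L, hL⟩ := exists_leftInverse_toContinuousMultilinearMap (E := E) k
  have h : (fun p : (F [⋀^Fin k]→L[ℝ] ℝ) × (E →L[ℝ] F) ↦ p.1.compContinuousLinearMap p.2) =
      fun p ↦ L (ContinuousMultilinearMap.compContinuousLinearMapContinuousMultilinear ℝ
        (fun _ : Fin k ↦ E) (fun _ : Fin k ↦ F) ℝ (fun _ ↦ p.2)
          (ContinuousAlternatingMap.toContinuousMultilinearMapCLM ℝ p.1)) := by
    funext p
    exact (hL (p.1.compContinuousLinearMap p.2)).symm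
  rw [h]
  refine L.contDiff.comp (ContDiff.clm_apply ?_ ?_)
  · exact (ContinuousMultilinearMap.contDiff _).comp (contDiff_pi.2 fun _ ↦ contDiff_snd)
  · exact (ContinuousLinearMap.contDiff _).comp contDiff_fst

theorem two_le_infty : minSmoothness ℝ 2 ≤ (∞ : WithTop ℕ∞) := by
  rw [minSmoothness_of_isRCLikeNormedField]
  exact ENat.LEInfty.out

end Pullback

/-! ### Smooth differential forms and the exterior derivative -/

section Forms

open Set Bundle

variable {E : Type*} [NormedAddCommGroup E] [NormedSpace ℝ E]
  {H : Type*} [TopologicalSpace H] (I : ModelWithCorners ℝ E H)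
  {N : Type*} [TopologicalSpace N] [ChartedSpace H N]

/-- The space `Λᵏ T*ₓN` of alternating `k`-linear forms on the tangent space at `x`. -/
abbrev FormAt (k : ℕ) (x : N) : Type _ :=
  TangentSpace I x [⋀^Fin k]→L[ℝ] Bundle.Trivial N ℝ x

/-- The representative of a form `α` in the chart around `x₀`: the pullback of `α` along the
inverse of the (extended) chart, a form on the model space `E` (relevant on the chart target,
which lies in `range I`). -/
def chartRep {k : ℕ} (α : ∀ x : N, FormAt I k x) (x₀ : N) (y : E) : E [⋀^Fin k]→L[ℝ] ℝ :=
  (α ((extChartAt I x₀).symm y)).compContinuousLinearMap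
    (mfderivWithin 𝓘(ℝ, E) I (extChartAt I x₀).symm (range I) y)

/-- The exterior derivative `(dα)ₓ`: the exterior derivative of the representative of `α` in the
chart around `x`, pulled back to `TₓN` by the differential of the chart. By
`chartRep_extDerivAt` below, any other chart gives the same result. -/
def extDerivAt {k : ℕ} (α : ∀ x : N, FormAt I k x) (x : N) : FormAt I (k + 1) x :=
  (extDerivWithin (chartRep I α x) (range I) (extChartAt I x x)).compContinuousLinearMap
    (mfderiv I 𝓘(ℝ, E) (extChartAt I x) x)

/-- Values of a form at equal points agree (all tangent spaces are modelled on `E`). -/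
theorem FormAt.congr_point {k : ℕ} (α : ∀ x : N, FormAt I k x) {x y : N} (h : x = y)
    (v : Fin k → E) :
    (α x) (v : Fin k → TangentSpace I x) = α y (v : Fin k → TangentSpace I y) := by
  subst h; rfl

theorem chartRep_apply {k : ℕ} (α : ∀ x : N, FormAt I k x) (x₀ : N) (y : E) (v : Fin k → E) :
    chartRep I α x₀ y v = α ((extChartAt I x₀).symm y) (fun i ↦
      mfderivWithin 𝓘(ℝ, E) I (extChartAt I x₀).symm (range I) y (v i)) := rfl

variable [IsManifold I ∞ N]

variable (N) in
/-- The real vector space `Ωᵏ(N)` of smooth `k`-forms: smooth sections of `Λᵏ T*N`. -/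
abbrev Form (k : ℕ) : Type _ :=
  ContMDiffSection I (E [⋀^Fin k]→L[ℝ] ℝ) ∞ (fun x : N ↦ FormAt I k x)

variable {I}

theorem trivializationAt_apply_eq_chartRep {k : ℕ} (α : ∀ x : N, FormAt I k x) (x₀ x : N)
    (hx : x ∈ (chartAt H x₀).source) :
    (trivializationAt (E [⋀^Fin k]→L[ℝ] ℝ) (fun x : N ↦ FormAt I k x) x₀ ⟨x, α x⟩).2 =
      chartRep I α x₀ (extChartAt I x₀ x) := by
  have h : (extChartAt I x₀).symm (extChartAt I x₀ x) = x :=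
    (extChartAt I x₀).left_inv (by simpa using hx)
  rw [FiberBundle.trivializationAt_continuousAlternatingMap_apply]
  ext v
  rw [chartRep_apply]
  refine Eq.trans ?_ (FormAt.congr_point I α h _).symm
  have h2 := TangentBundle.symmL_trivializationAt (I := I) hx
  have h3 : ∀ w : E, (trivializationAt E (TangentSpace I) x₀).symmL ℝ x w =
      mfderivWithin 𝓘(ℝ, E) I (extChartAt I x₀).symm (range I) (extChartAt I x₀ x) w := fun w ↦
    DFunLike.congr_fun h2 w
  have h4 : (ContinuousAlternatingMap.inCoordinates E ℝ x₀ x x₀ x (α x)) v =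
    α x (fun i ↦ (trivializationAt E (TangentSpace I) x₀).symmL ℝ x (v i)) := by
    simp [ContinuousAlternatingMap.inCoordinates, Function.comp_def]
  refine h4.trans ?_
  exact congrArg (α x) (funext fun i ↦ h3 (v i))

theorem contMDiff_of_chartRep {k : ℕ} (α : ∀ x : N, FormAt I k x)
    (h : ∀ x₀ : N, ContDiffWithinAt ℝ ∞ (chartRep I α x₀) (range I) (extChartAt I x₀ x₀)) :
    ContMDiff I (I.prod 𝓘(ℝ, E [⋀^Fin k]→L[ℝ] ℝ)) ∞
      (fun x ↦ TotalSpace.mk' (E [⋀^Fin k]→L[ℝ] ℝ) (E := fun x : N ↦ FormAt I k x) x (α x)) := by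
  intro x₀
  rw [contMDiffAt_section]
  have h1 : ContMDiffAt I 𝓘(ℝ, E [⋀^Fin k]→L[ℝ] ℝ) ∞
      (fun x : N ↦ chartRep I α x₀ (extChartAt I x₀ x)) x₀ := by
    have h2 := (h x₀).contMDiffWithinAt
    have h3 := h2.comp x₀ (contMDiffAt_extChartAt (I := I) (n := ∞) (x := x₀)).contMDiffWithinAt
      (s := univ) (fun x _ ↦ mem_range_self _)
    exact h3
  refine h1.congr_of_eventuallyEq ?_
  filter_upwards [(chartAt H x₀).open_source.mem_nhds (mem_chart_source H x₀)] with x hx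
  exact trivializationAt_apply_eq_chartRep α x₀ x hx

theorem contDiffWithinAt_chartRep_self {k : ℕ} (α : Form I N k) (x₀ : N) :
    ContDiffWithinAt ℝ ∞ (chartRep I α x₀) (range I) (extChartAt I x₀ x₀) := by
  have h1 : ContMDiffAt I 𝓘(ℝ, E [⋀^Fin k]→L[ℝ] ℝ) ∞
      (fun x : N ↦ chartRep I α x₀ (extChartAt I x₀ x)) x₀ := by
    have h2 := (contMDiffAt_section x₀).1 (α.contMDiff x₀)
    refine h2.congr_of_eventuallyEq ?_
    filter_upwards [(chartAt H x₀).open_source.mem_nhds (mem_chart_source H x₀)] with x hx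
    exact (trivializationAt_apply_eq_chartRep α x₀ x hx).symm
  rw [contMDiffAt_iff] at h1
  refine h1.2.congr_of_eventuallyEq ?_ ?_
  · filter_upwards [extChartAt_target_mem_nhdsWithin x₀] with y hy
    exact congrArg (chartRep I α x₀) ((extChartAt I x₀).right_inv hy).symm
  · exact congrArg (chartRep I α x₀) ((extChartAt I x₀).right_inv (mem_extChartAt_target x₀)).symm

theorem chartRep_eventuallyEq {k : ℕ} (α : ∀ x : N, FormAt I k x) (x₀ x₁ : N) {y : E}
    (hy : y ∈ (extChartAt I x₁).target)
    (hy' : (extChartAt I x₁).symm y ∈ (extChartAt I x₀).source) :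
    chartRep I α x₁ =ᶠ[𝓝[range I] y] fun z ↦
      (chartRep I α x₀ ((extChartAt I x₀ ∘ (extChartAt I x₁).symm) z)).compContinuousLinearMap
        (fderivWithin ℝ (extChartAt I x₀ ∘ (extChartAt I x₁).symm) (range I) z) := by
  have hs : ((extChartAt I x₁).symm ≫ extChartAt I x₀).source ∈ 𝓝[range I] y :=
    I.extendCoordChange_source_mem_nhdsWithin (e := chartAt H x₁) (e' := chartAt H x₀)
      ⟨hy, hy'⟩
  filter_upwards [hs] with z hz
  obtain ⟨hz1, hz2⟩ : z ∈ (extChartAt I x₁).target ∧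
    (extChartAt I x₁).symm z ∈ (extChartAt I x₀).source := hz
  have hzr : z ∈ range I := extChartAt_target_subset_range x₁ hz1
  have hinv : (extChartAt I x₀).symm ((extChartAt I x₀ ∘ (extChartAt I x₁).symm) z) =
    (extChartAt I x₁).symm z := (extChartAt I x₀).left_inv hz2
  have hf : ContMDiffWithinAt 𝓘(ℝ, E) 𝓘(ℝ, E) ∞ (extChartAt I x₀ ∘ (extChartAt I x₁).symm)
      (range I) z := (contDiffWithinAt_ext_coord_change x₀ x₁ ⟨hz1, hz2⟩).contMDiffWithinAt
  have hU : UniqueMDiffWithinAt 𝓘(ℝ, E) (range I) z := I.uniqueMDiffOn z hzr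
  have hev : (extChartAt I x₁).symm =ᶠ[𝓝[range I] z]
      (extChartAt I x₀).symm ∘ (extChartAt I x₀ ∘ (extChartAt I x₁).symm) := by
    have hs' : ((extChartAt I x₁).symm ≫ extChartAt I x₀).source ∈ 𝓝[range I] z :=
      I.extendCoordChange_source_mem_nhdsWithin (e := chartAt H x₁) (e' := chartAt H x₀)
        ⟨hz1, hz2⟩
    filter_upwards [hs'] with w hw
    exact ((extChartAt I x₀).left_inv hw.2).symm
  have hcomp : ∀ v : E, mfderivWithin 𝓘(ℝ, E) I (extChartAt I x₁).symm (range I) z v =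
      mfderivWithin 𝓘(ℝ, E) I (extChartAt I x₀).symm (range I)
        ((extChartAt I x₀ ∘ (extChartAt I x₁).symm) z)
        (fderivWithin ℝ (extChartAt I x₀ ∘ (extChartAt I x₁).symm) (range I) z v) := by
    intro v
    have h1 := hev.mfderivWithin_eq (I := 𝓘(ℝ, E)) (I' := I) (hev.self_of_nhdsWithin hzr)
    have h2 := mfderivWithin_comp (I := 𝓘(ℝ, E)) (I' := 𝓘(ℝ, E)) (I'' := I) z
      (g := (extChartAt I x₀).symm) (f := extChartAt I x₀ ∘ (extChartAt I x₁).symm)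
      (s := range I) (u := range I)
      (mdifferentiableWithinAt_extChartAt_symm ((extChartAt I x₀).map_source hz2))
      (hf.mdifferentiableWithinAt (by simp)) (fun w _ ↦ mem_range_self _) hU
    rw [mfderivWithin_eq_fderivWithin] at h2
    exact (DFunLike.congr_fun h1 v).trans (DFunLike.congr_fun h2 v)
  ext v
  rw [chartRep_apply, ContinuousAlternatingMap.compContinuousLinearMap_apply, chartRep_apply]
  refine Eq.trans ?_ (FormAt.congr_point I α hinv _).symm
  exact congrArg (α _) (funext fun i ↦ hcomp (v i))

theorem contDiffWithinAt_chartRep {k : ℕ} (α : Form I N k) (x₀ : N) {y : E}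
    (hy : y ∈ (extChartAt I x₀).target) :
    ContDiffWithinAt ℝ ∞ (chartRep I α x₀) (range I) y := by
  set x₁ := (extChartAt I x₀).symm y with hx₁
  have hyr := extChartAt_target_subset_range x₀ hy
  have h := chartRep_eventuallyEq α x₁ x₀ hy (mem_extChartAt_source x₁)
  refine ContDiffWithinAt.congr_of_eventuallyEq ?_ h (h.self_of_nhdsWithin hyr)
  have hf : ContDiffWithinAt ℝ ∞ (extChartAt I x₁ ∘ (extChartAt I x₀).symm) (range I) y :=
    contDiffWithinAt_ext_coord_change x₁ x₀ ⟨hy, mem_extChartAt_source x₁⟩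
  refine (contDiff_compContinuousLinearMap k).contDiffAt.comp_contDiffWithinAt y
    (ContDiffWithinAt.prodMk ?_ ?_)
  · exact ContDiffWithinAt.comp (t := range I) y (contDiffWithinAt_chartRep_self α x₁) hf
      (fun w _ ↦ mem_range_self _)
  · exact hf.fderivWithin_right I.uniqueDiffOn (by simp) hyr

/-- In every chart, `dα` is the exterior derivative of the chart representative of `α`. -/
theorem chartRep_extDerivAt {k : ℕ} (α : Form I N k) (x₀ : N) {y : E}
    (hy : y ∈ (extChartAt I x₀).target) :
    chartRep I (extDerivAt I α) x₀ y = extDerivWithin (chartRep I α x₀) (range I) y := by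
  set x₁ := (extChartAt I x₀).symm y with hx₁
  have hyr := extChartAt_target_subset_range x₀ hy
  have h := chartRep_eventuallyEq α x₁ x₀ hy (mem_extChartAt_source x₁)
  have hf : ContDiffWithinAt ℝ ∞ (extChartAt I x₁ ∘ (extChartAt I x₀).symm) (range I) y :=
    contDiffWithinAt_ext_coord_change x₁ x₀ ⟨hy, mem_extChartAt_source x₁⟩
  have h1 := h.extDerivWithin_eq (h.self_of_nhdsWithin hyr)
  have hd : DifferentiableWithinAt ℝ (chartRep I α x₁) (range I)
      ((extChartAt I x₁ ∘ (extChartAt I x₀).symm) y) :=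
    (contDiffWithinAt_chartRep_self α x₁).differentiableWithinAt (by simp)
  have h2 := extDerivWithin_pullback (t := range I) hd hf
    two_le_infty I.uniqueDiffOn (I.range_subset_closure_interior hyr) hyr
    (fun w _ ↦ mem_range_self _)
  rw [h1, h2]
  have hcomp : ∀ v : E, mfderiv I 𝓘(ℝ, E) (extChartAt I x₁) x₁
      (mfderivWithin 𝓘(ℝ, E) I (extChartAt I x₀).symm (range I) y v) =
        fderivWithin ℝ (extChartAt I x₁ ∘ (extChartAt I x₀).symm) (range I) y v := by
    intro v
    have h3 := mfderiv_comp_mfderivWithin (I := 𝓘(ℝ, E)) (I' := I) (I'' := 𝓘(ℝ, E)) y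
      (g := extChartAt I x₁) (f := (extChartAt I x₀).symm) (s := range I)
      (mdifferentiableAt_extChartAt (mem_chart_source H x₁))
      (mdifferentiableWithinAt_extChartAt_symm hy) (I.uniqueMDiffOn y hyr)
    rw [mfderivWithin_eq_fderivWithin] at h3
    exact (DFunLike.congr_fun h3 v).symm
  ext v
  rw [chartRep_apply, ContinuousAlternatingMap.compContinuousLinearMap_apply]
  exact congrArg (extDerivWithin (chartRep I α x₁) (range I) (extChartAt I x₁ x₁))
    (funext fun i ↦ hcomp (v i))


theorem contDiffWithinAt_extDerivWithin {k : ℕ} {f : E → E [⋀^Fin k]→L[ℝ] ℝ} {y : E}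
    (hy : y ∈ range I) (h : ContDiffWithinAt ℝ ∞ f (range I) y) :
    ContDiffWithinAt ℝ ∞ (extDerivWithin f (range I)) (range I) y := by
  have hL : (fun L : E →L[ℝ] E [⋀^Fin k]→L[ℝ] ℝ ↦
      ContinuousAlternatingMap.alternatizeUncurryFin L) =
      ⇑(ContinuousAlternatingMap.alternatizeUncurryFinCLM (n := k) ℝ E ℝ) :=
    funext fun L ↦ (ContinuousAlternatingMap.alternatizeUncurryFinCLM_apply L).symm
  have hc : ContDiff ℝ ∞ (fun L : E →L[ℝ] E [⋀^Fin k]→L[ℝ] ℝ ↦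
      ContinuousAlternatingMap.alternatizeUncurryFin L) := by
    rw [hL]
    exact ContinuousLinearMap.contDiff _
  exact hc.comp_contDiffWithinAt (h.fderivWithin_right I.uniqueDiffOn (m := ∞) (by simp) hy)

variable (I) in
/-- The exterior derivative of a smooth form, as a smooth form. -/
def extDerivForm {k : ℕ} (α : Form I N k) : Form I N (k + 1) where
  toFun := extDerivAt I α
  contMDiff_toFun := contMDiff_of_chartRep _ fun x₀ ↦ by
    refine (contDiffWithinAt_extDerivWithin (mem_range_self _)
      (contDiffWithinAt_chartRep_self α x₀)).congr_of_eventuallyEq ?_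
      (chartRep_extDerivAt α x₀ (mem_extChartAt_target x₀))
    filter_upwards [extChartAt_target_mem_nhdsWithin x₀] with y hy
    exact chartRep_extDerivAt α x₀ hy

@[simp] theorem extDerivForm_apply {k : ℕ} (α : Form I N k) (x : N) :
    extDerivForm I α x = extDerivAt I α x := rfl

theorem chartRep_add {k : ℕ} (α β : Form I N k) (x₀ : N) :
    chartRep I (α + β : Form I N k) x₀ = chartRep I α x₀ + chartRep I β x₀ := by
  funext y; ext v; rfl

theorem chartRep_smul {k : ℕ} (c : ℝ) (α : Form I N k) (x₀ : N) :
    chartRep I (c • α : Form I N k) x₀ = c • chartRep I α x₀ := by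
  funext y; ext v; rfl

variable (I N) in
/-- The de Rham differential `d : Ωᵏ(N) → Ωᵏ⁺¹(N)`. -/
def extD (k : ℕ) : Form I N k →ₗ[ℝ] Form I N (k + 1) where
  toFun := extDerivForm I
  map_add' α β := by
    refine ContMDiffSection.ext fun x ↦ ?_
    have h := extDerivWithin_add (I.uniqueDiffOn _ (mem_range_self _))
      ((contDiffWithinAt_chartRep_self α x).differentiableWithinAt (by simp))
      ((contDiffWithinAt_chartRep_self β x).differentiableWithinAt (by simp))
    rw [← chartRep_add] at h
    ext v
    exact DFunLike.congr_fun h _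
  map_smul' c α := by
    refine ContMDiffSection.ext fun x ↦ ?_
    have h := extDerivWithin_smul c (chartRep I α x)
      (I.uniqueDiffOn (extChartAt I x x) (mem_range_self _))
    rw [← chartRep_smul] at h
    ext v
    exact DFunLike.congr_fun h _

theorem extD_extD {k : ℕ} (α : Form I N k) : extD I N (k + 1) (extD I N k α) = 0 := by
  refine ContMDiffSection.ext fun x ↦ ?_
  have hx := mem_extChartAt_target (I := I) x
  have h1 : chartRep I (extDerivAt I α) x =ᶠ[𝓝[range I] (extChartAt I x x)]
      extDerivWithin (chartRep I α x) (range I) := by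
    filter_upwards [extChartAt_target_mem_nhdsWithin x] with y hy
    exact chartRep_extDerivAt α x hy
  have h2 := h1.extDerivWithin_eq (chartRep_extDerivAt α x hx)
  have h3 := extDerivWithin_extDerivWithin_apply (contDiffWithinAt_chartRep_self α x)
    two_le_infty I.uniqueDiffOn
    (I.range_subset_closure_interior (mem_range_self _)) (mem_range_self _)
  ext v
  exact DFunLike.congr_fun (h2.trans h3) _

variable (I) in
/-- The support of a form: the closure of the set of points where it does not vanish. -/
def support {k : ℕ} (α : Form I N k) : Set N := closure {x | α x ≠ 0}

theorem support_extD {k : ℕ} (α : Form I N k) : support I (extD I N k α) ⊆ support I α := by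
  refine closure_minimal ?_ isClosed_closure
  intro x hx
  by_contra hxs
  apply hx
  have h0 : ∀ᶠ y in 𝓝 x, α y = 0 := by
    filter_upwards [isClosed_closure.isOpen_compl.mem_nhds hxs] with y hy
    by_contra hne
    exact hy (subset_closure hne)
  have h1 : chartRep I α x =ᶠ[𝓝[range I] (extChartAt I x x)] 0 := by
    have h2 := (continuousAt_extChartAt_symm (I := I) x)
    have h3 : ∀ᶠ y in 𝓝 ((extChartAt I x).symm (extChartAt I x x)), α y = 0 := by
      rwa [extChartAt_to_inv]
    filter_upwards [nhdsWithin_le_nhds (h2.eventually h3)] with y hy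
    ext v
    rw [chartRep_apply]
    rw [hy]
    rfl
  have h2 := h1.extDerivWithin_eq (h1.self_of_nhdsWithin (mem_range_self _))
  have h3 : extDerivWithin (0 : E → E [⋀^Fin k]→L[ℝ] ℝ) (range I) (extChartAt I x x) = 0 := by
    rw [extDerivWithin, fderivWithin_zero]
    exact map_zero (ContinuousAlternatingMap.alternatizeUncurryFinCLM ℝ E ℝ)
  ext v
  exact DFunLike.congr_fun (h2.trans h3) _

variable (I N) in
/-- The space `Ωᵏ_c(N)` of smooth `k`-forms with compact support. -/
def FormC (k : ℕ) : Submodule ℝ (Form I N k) where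
  carrier := {α | IsCompact (support I α)}
  zero_mem' := by simp [support]
  add_mem' {α β} hα hβ := by
    refine (IsCompact.union hα hβ).of_isClosed_subset isClosed_closure ?_
    rw [support, support, support, ← closure_union]
    refine closure_mono fun x hx ↦ ?_
    by_contra hne
    rw [mem_union, not_or] at hne
    simp only [mem_ofPred_eq, not_not] at hne
    apply hx
    rw [ContMDiffSection.coe_add, Pi.add_apply, hne.1, hne.2, add_zero]
  smul_mem' c α hα := by
    refine IsCompact.of_isClosed_subset hα isClosed_closure (closure_mono fun x hx ↦ ?_)
    intro h0
    apply hx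
    rw [ContMDiffSection.coe_smul, Pi.smul_apply, h0, smul_zero]

variable (I N) in
/-- The de Rham differential on compactly supported forms. -/
def extDC (k : ℕ) : FormC I N k →ₗ[ℝ] FormC I N (k + 1) :=
  (extD I N k).restrict fun α hα ↦
    IsCompact.of_isClosed_subset hα isClosed_closure (support_extD α)

end Forms

/-! ### The de Rham complexes -/

section Complexes

open CategoryTheory CochainComplex.HomComplex

universe u v w

variable {E : Type u} [NormedAddCommGroup E] [NormedSpace ℝ E]
  {H : Type w} [TopologicalSpace H] (I : ModelWithCorners ℝ E H)
  (N : Type v) [TopologicalSpace N] [ChartedSpace H N] [IsManifold I ∞ N]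

/-- `Ωⁱ(N)` for `i : ℤ`; it is zero for `i < 0`. -/
def deRhamX : ℤ → ModuleCat.{max u v} ℝ
  | Int.ofNat k => ModuleCat.of ℝ (Form I N k)
  | Int.negSucc _ => ModuleCat.of ℝ PUnit

/-- The differential of the de Rham complex. -/
def deRhamD : ∀ i : ℤ, deRhamX I N i ⟶ deRhamX I N (i + 1)
  | Int.ofNat k => ModuleCat.ofHom (extD I N k)
  | Int.negSucc _ => 0

/-- The de Rham complex `Ω^•(N)`. -/
def deRham : CochainComplex (ModuleCat.{max u v} ℝ) ℤ :=
  CochainComplex.of (deRhamX I N) (deRhamD I N) fun i ↦ by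
    rcases i with k | k
    · exact ModuleCat.hom_ext (LinearMap.ext fun α ↦ extD_extD α)
    · simp [deRhamD]

/-- `Ωⁱ_c(N)` for `i : ℤ`; it is zero for `i < 0`. -/
def deRhamCX : ℤ → ModuleCat.{max u v} ℝ
  | Int.ofNat k => ModuleCat.of ℝ (FormC I N k)
  | Int.negSucc _ => ModuleCat.of ℝ PUnit

/-- The differential of the compactly supported de Rham complex. -/
def deRhamCD : ∀ i : ℤ, deRhamCX I N i ⟶ deRhamCX I N (i + 1)
  | Int.ofNat k => ModuleCat.ofHom (extDC I N k)
  | Int.negSucc _ => 0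

/-- The complex `Ω_c^•(N)` of compactly supported forms. -/
def deRhamC : CochainComplex (ModuleCat.{max u v} ℝ) ℤ :=
  CochainComplex.of (deRhamCX I N) (deRhamCD I N) fun i ↦ by
    rcases i with k | k
    · exact ModuleCat.hom_ext (LinearMap.ext fun α ↦ Subtype.ext (extD_extD α.1))
    · simp [deRhamCD]

/-- The components of the inclusion of compactly supported forms into all forms. -/
def inclX : ∀ i : ℤ, deRhamCX I N i ⟶ deRhamX I N i
  | Int.ofNat k => ModuleCat.ofHom (FormC I N k).subtype
  | Int.negSucc _ => 0

/-- The canonical inclusion cochain map `j : Ω_c^•(N) ⟶ Ω^•(N)`. -/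
def incl : deRhamC I N ⟶ deRham I N where
  f := inclX I N
  comm' i j hij := by
    obtain rfl : i + 1 = j := hij
    change CategoryStruct.comp (inclX I N i) (CochainComplex.of.d (deRhamX I N) _ _ _) =
      CategoryStruct.comp (CochainComplex.of.d (deRhamCX I N) _ _ _) _
    rw [CochainComplex.of_d, CochainComplex.of_d]
    rcases i with k | k
    · rfl
    · simp [deRhamD, deRhamCD]

variable {N}

/-- The component `Ω_c^{k+1}(N) → Ωᵏ(N)` of an element of degree `-1` of the internal hom complex
`[Ω_c^•(N), Ω^•(N)]`. (All other components have target zero.) -/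
def component (G : Cochain (deRhamC I N) (deRham I N) (-1)) (k : ℕ) :
    FormC I N (k + 1) →ₗ[ℝ] Form I N k :=
  (G.v (Int.ofNat (k + 1)) (Int.ofNat k) (by simp)).hom

end Complexes

/-! ### Fiber integration and Green homotopies of an action of `ℝ` -/

section Action

open CategoryTheory CochainComplex.HomComplex MeasureTheory

universe u v w

variable {E : Type u} [NormedAddCommGroup E] [NormedSpace ℝ E]
  {H : Type w} [TopologicalSpace H] (I : ModelWithCorners ℝ E H)
  {N : Type v} [TopologicalSpace N] [ChartedSpace H N]

/-- `β` is the integral of the `(k+1)`-form `ω` on `ℝ × N` over the part `S ⊆ ℝ` of the fibers of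
the projection `ℝ × N → N`, in the fiber-first convention:
`β_p(v₁, …, v_k) = ∫_S ω_{(s,p)}(∂_s, (0, v₁), …, (0, v_k)) ds`, all integrals being convergent. -/
def IsFiberIntegral {k : ℕ} (S : Set ℝ) (ω' : ∀ z : ℝ × N, FormAt (𝓘(ℝ, ℝ).prod I) (k + 1) z)
    (β : ∀ p : N, FormAt I k p) : Prop :=
  ∀ (p : N) (v : Fin k → TangentSpace I p),
    IntegrableOn (fun s : ℝ ↦ (ω' (s, p)
      (Matrix.vecCons ((1 : ℝ), (0 : E)) fun i ↦ ((0 : ℝ), (v i : E))) : ℝ)) S ∧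
    (β p v : ℝ) = ∫ s in S, (ω' (s, p)
      (Matrix.vecCons ((1 : ℝ), (0 : E)) fun i ↦ ((0 : ℝ), (v i : E))) : ℝ)

variable [AddAction ℝ N]

/-- The future of `S` under the action `Θ(s, p) = s +ᵥ p`. -/
def future (S : Set N) : Set N := {q | ∃ p ∈ S, ∃ s : ℝ, 0 ≤ s ∧ q = s +ᵥ p}

/-- The past of `S` under the action `Θ(s, p) = s +ᵥ p`. -/
def past (S : Set N) : Set N := {q | ∃ p ∈ S, ∃ s : ℝ, s ≤ 0 ∧ q = s +ᵥ p}

/-- The pullback `Θ^*α` of a form on `N` along the action map `Θ : ℝ × N → N`. -/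
def actionPullback {k : ℕ} (α : ∀ p : N, FormAt I k p) (z : ℝ × N) :
    FormAt (𝓘(ℝ, ℝ).prod I) k z :=
  (α (z.1 +ᵥ z.2)).compContinuousLinearMap
    (mfderiv (𝓘(ℝ, ℝ).prod I) I (fun w : ℝ × N ↦ w.1 +ᵥ w.2) z)

variable [IsManifold I ∞ N]

/-- `G` is `∫_{ℝ^{≤0}} Θ^*`. -/
def IsForwardIntegral (G : Cochain (deRhamC I N) (deRham I N) (-1)) : Prop :=
  ∀ (k : ℕ) (α : FormC I N (k + 1)),
    IsFiberIntegral I (Set.Iic 0) (actionPullback I α.1) (component I G k α)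

/-- `G` is `-∫_{ℝ^{≥0}} Θ^*`. -/
def IsBackwardIntegral (G : Cochain (deRhamC I N) (deRham I N) (-1)) : Prop :=
  ∀ (k : ℕ) (α : FormC I N (k + 1)),
    IsFiberIntegral I (Set.Ici 0) (actionPullback I α.1) (-component I G k α : Form I N k)

/-- Forward Green homotopies of the de Rham complex: elements `G` of degree `-1` of the internal
hom complex `[Ω_c^•(N), Ω^•(N)]` with `∂G = j` and `supp (G α)` in the future of `supp α`. -/
structure IsForwardGreenHomotopy (G : Cochain (deRhamC I N) (deRham I N) (-1)) : Prop where
  boundary_eq : δ (-1) 0 G = Cochain.ofHom (incl I N)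
  support_subset : ∀ (k : ℕ) (α : FormC I N (k + 1)),
    support I (component I G k α) ⊆ future (support I α.1)

/-- Backward Green homotopies of the de Rham complex: elements `G` of degree `-1` of the internal
hom complex `[Ω_c^•(N), Ω^•(N)]` with `∂G = j` and `supp (G α)` in the past of `supp α`. -/
structure IsBackwardGreenHomotopy (G : Cochain (deRhamC I N) (deRham I N) (-1)) : Prop where
  boundary_eq : δ (-1) 0 G = Cochain.ofHom (incl I N)
  support_subset : ∀ (k : ℕ) (α : FormC I N (k + 1)),
    support I (component I G k α) ⊆ past (support I α.1)

end Action

end GreenHomotopy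

end

/-!
The idea is that of Cartan's homotopy formula. Let `Ω = Θ^*α` on `ℝ × N` and let `ι` denote the
contraction with `∂ₛ` followed by the restriction to the slices `{s} × N`. Then
`ι dΩ = ∂ₛ(Ω|_{slice}) - d ι Ω`, so that, for all real `c`,
`d ∫_c^0 ι Ω ds + ∫_c^0 ι dΩ ds = Θ_0^*α - Θ_c^*α = α - Θ_c^*α`.
As the action is proper and `α` has compact support, every point has a neighborhood on which `ι Ω`
and `Θ_s^*α` vanish for all `|s| > R` (`exists_vadd_notMem_of_isCompact`). On this neighborhood the
integral over a half-line is an integral over a bounded interval with one end at `0`, up to sign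
(`IsSignedHalfLine.smul_integral_eq`), and the term `Θ_c^*α` vanishes for `|c| > R`; this treats the
forward and the backward case at once.

All statements about derivatives are local and are checked in a chart `ψ` around `x₀`. There `Ω` is
the pullback of `α` along `(s, y) ↦ Θ(s, ψ⁻¹ y)`, defined on an open subset of `ℝ × range I`
(`pullbackWithin`, `flowBox`); it is smooth, and pulling back commutes with `d`
(`extDerivWithin_pullbackWithin`). Only the source is put in a single chart: the chart of the target
varies with the point. Since the manifold may have boundary and corners, the integrals depend on
a parameter in a set which is not open. But `range I` is convex, so a small ball cuts out a convex
set, and there the mean value inequality gives differentiation under the integral sign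
(`hasFDerivWithinAt_parametric_integral`) and smoothness (`contDiffOn_parametric_integral`). The
homotopy formula on `ℝ × u` with `u` convex is `extDerivWithin_integral_contractTime`; in degree
zero the term `d ι Ω` is absent (`integral_contractTime_extDerivWithin_zero`).

For the supports: if `ε ∫_S Θ^*α` does not vanish at `q`, then `t +ᵥ q ∈ supp α` for some `t ∈ S`,
so `q` lies in the orbit of `supp α` under `-S`; this set is closed because a proper map is closed
(`isClosed_image_vadd_of_isCompact`).
-/

noncomputable section

namespace GreenHomotopy

/-! ### Smooth dependence of integrals on a parameter in a convex set -/

section ParametricIntegral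

open Set MeasureTheory

universe u

variable {E : Type u} [NormedAddCommGroup E]

theorem intervalIntegrable_slice {G : Type*} [NormedAddCommGroup G] {u : Set E} {F : ℝ × E → G}
    (hF : ContinuousOn F (univ ×ˢ u)) {y : E} (hy : y ∈ u) (a b : ℝ) :
    IntervalIntegrable (fun t ↦ F (t, y)) volume a b := by
  refine Continuous.intervalIntegrable ?_ a b
  exact continuousOn_univ.1 (hF.comp (by fun_prop) fun t _ ↦ ⟨mem_univ _, hy⟩)

/-- Uniformity in `t ∈ [a, b]` of the continuity in the parameter `y`. -/
theorem exists_ball_norm_sub_lt {G : Type*} [NormedAddCommGroup G] {u : Set E} {F : ℝ × E → G}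
    (hF : ContinuousOn F (univ ×ˢ u)) {y : E} (hy : y ∈ u) (a b : ℝ) {ε : ℝ} (hε : 0 < ε) :
    ∃ δ > 0, ∀ z ∈ u ∩ Metric.ball y δ, ∀ t ∈ uIcc a b, ‖F (t, z) - F (t, y)‖ < ε := by
  have hc : ContinuousOn (Function.uncurry fun (z : E) (t : ℝ) ↦ F (t, z)) (u ×ˢ uIcc a b) :=
    hF.comp (f := Prod.swap) (by fun_prop) fun z hz ↦ ⟨mem_univ _, hz.1⟩
  obtain ⟨v, hv, h⟩ := isCompact_uIcc.mem_uniformity_of_prod hc hy (Metric.dist_mem_uniformity hε)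
  obtain ⟨δ, hδ, hv⟩ := Metric.mem_nhdsWithin_iff.1 hv
  refine ⟨δ, hδ, fun z hz t ht ↦ ?_⟩
  rw [← dist_eq_norm]
  exact h z (hv ⟨hz.2, hz.1⟩) t ht

theorem continuousOn_parametric_integral {G : Type*} [NormedAddCommGroup G] [NormedSpace ℝ G]
    {u : Set E} {F : ℝ × E → G} (hF : ContinuousOn F (univ ×ˢ u)) (a b : ℝ) :
    ContinuousOn (fun y ↦ ∫ t in a..b, F (t, y)) u := by
  intro y hy
  rw [ContinuousWithinAt, Metric.tendsto_nhdsWithin_nhds]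
  intro ε hε
  have hp : 0 < ε / (|b - a| + 1) := by positivity
  obtain ⟨δ, hδ, h⟩ := exists_ball_norm_sub_lt hF hy a b hp
  refine ⟨δ, hδ, fun z hz hzy ↦ ?_⟩
  rw [dist_eq_norm, ← intervalIntegral.integral_sub (intervalIntegrable_slice hF hz a b)
    (intervalIntegrable_slice hF hy a b)]
  refine (intervalIntegral.norm_integral_le_of_norm_le_const
    fun t ht ↦ (h z ⟨hz, hzy⟩ t (uIoc_subset_uIcc ht)).le).trans_lt ?_
  rw [div_mul_eq_mul_div, div_lt_iff₀ (by positivity)]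
  nlinarith [abs_nonneg (b - a)]

variable [NormedSpace ℝ E]

/-- Differentiation under the integral sign within a convex set, which may have boundary: the mean
value inequality along segments replaces the dominated convergence argument on a ball. -/
theorem hasFDerivWithinAt_parametric_integral {G : Type*} [NormedAddCommGroup G] [NormedSpace ℝ G]
    [CompleteSpace G] {u : Set E} (hu : Convex ℝ u) {F : ℝ × E → G} {F' : ℝ × E → E →L[ℝ] G}
    (hF : ContinuousOn F (univ ×ˢ u)) (hF' : ContinuousOn F' (univ ×ˢ u))
    (hd : ∀ t, ∀ y ∈ u, HasFDerivWithinAt (fun z ↦ F (t, z)) (F' (t, y)) u y) (a b : ℝ)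
    {y : E} (hy : y ∈ u) :
    HasFDerivWithinAt (fun z ↦ ∫ t in a..b, F (t, z)) (∫ t in a..b, F' (t, y)) u y := by
  rw [hasFDerivWithinAt_iff_isLittleO, Asymptotics.isLittleO_iff]
  intro ε hε
  have hp : 0 < ε / (|b - a| + 1) := by positivity
  obtain ⟨δ, hδ, h⟩ := exists_ball_norm_sub_lt hF' hy a b hp
  have hmem : u ∩ Metric.ball y δ ∈ 𝓝[u] y :=
    inter_mem_nhdsWithin _ (Metric.ball_mem_nhds y hδ)
  filter_upwards [hmem] with z hz
  have hI := intervalIntegrable_slice hF' hy a b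
  have h1 : (∫ t in a..b, F' (t, y)) (z - y) = ∫ t in a..b, F' (t, y) (z - y) :=
    (((ContinuousLinearMap.apply ℝ G) (z - y)).intervalIntegral_comp_comm hI).symm
  have hI' : IntervalIntegrable (fun t ↦ F' (t, y) (z - y)) volume a b :=
    intervalIntegrable_slice (F := fun p ↦ F' p (z - y)) (hF'.clm_apply continuousOn_const) hy a b
  have hFz := intervalIntegrable_slice hF hz.1 a b
  have hFy := intervalIntegrable_slice hF hy a b
  rw [h1, ← intervalIntegral.integral_sub hFz hFy,
    ← intervalIntegral.integral_sub (hFz.sub hFy) hI']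
  have hb : ∀ t ∈ uIoc a b,
      ‖F (t, z) - F (t, y) - F' (t, y) (z - y)‖ ≤ ε / (|b - a| + 1) * ‖z - y‖ := by
    intro t ht
    exact Convex.norm_image_sub_le_of_norm_hasFDerivWithin_le' (𝕜 := ℝ)
      (s := u ∩ Metric.ball y δ) (f' := fun w ↦ F' (t, w))
      (fun w hw ↦ (hd t w hw.1).mono inter_subset_left)
      (fun w hw ↦ (h w hw t (uIoc_subset_uIcc ht)).le)
      (hu.inter (convex_ball y δ)) ⟨hy, Metric.mem_ball_self hδ⟩ hz
  refine (intervalIntegral.norm_integral_le_of_norm_le_const hb).trans ?_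
  rw [mul_right_comm]
  refine mul_le_mul_of_nonneg_right ?_ (norm_nonneg _)
  rw [div_mul_eq_mul_div, div_le_iff₀ (by positivity)]
  nlinarith [abs_nonneg (b - a)]

/-- The partial derivative in the second variable of a function differentiable within a product. -/
theorem hasFDerivWithinAt_slice {G : Type*} [NormedAddCommGroup G] [NormedSpace ℝ G] {u : Set E}
    {F : ℝ × E → G} {F' : ℝ × E →L[ℝ] G} {t : ℝ} {y : E}
    (h : HasFDerivWithinAt F F' (univ ×ˢ u) (t, y)) :
    HasFDerivWithinAt (fun z ↦ F (t, z)) (F' ∘L ContinuousLinearMap.inr ℝ ℝ E) u y :=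
  h.comp y (hasFDerivAt_prodMk_right t y).hasFDerivWithinAt fun _ hz ↦ ⟨mem_univ _, hz⟩

/-- The partial derivative in the first variable of a function differentiable within a product. -/
theorem hasDerivAt_slice {G : Type*} [NormedAddCommGroup G] [NormedSpace ℝ G] {u : Set E}
    {F : ℝ × E → G} {F' : ℝ × E →L[ℝ] G} {t : ℝ} {y : E} (hy : y ∈ u)
    (h : HasFDerivWithinAt F F' (univ ×ˢ u) (t, y)) :
    HasDerivAt (fun s ↦ F (s, y)) (F' (1, 0)) t := by
  have h1 := h.comp_hasDerivWithinAt (s := univ) t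
    ((hasDerivAt_id t).prodMk (hasDerivAt_const t y)).hasDerivWithinAt
    (fun _ _ ↦ mem_prod.2 ⟨mem_univ _, hy⟩)
  exact hasDerivWithinAt_univ.1 h1

theorem contDiffOn_parametric_integral_nat (n : ℕ) {G : Type u} [NormedAddCommGroup G]
    [NormedSpace ℝ G] [CompleteSpace G] {u : Set E} (hu : Convex ℝ u) (hu' : UniqueDiffOn ℝ u)
    {F : ℝ × E → G} (hF : ContDiffOn ℝ n F (univ ×ˢ u)) (a b : ℝ) :
    ContDiffOn ℝ n (fun y ↦ ∫ t in a..b, F (t, y)) u := by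
  induction n generalizing G with
  | zero =>
    rw [Nat.cast_zero, contDiffOn_zero] at hF ⊢
    exact continuousOn_parametric_integral hF a b
  | succ n ih =>
    have hS : UniqueDiffOn ℝ ((univ : Set ℝ) ×ˢ u) := uniqueDiffOn_univ.prod hu'
    push_cast at hF ⊢
    have h := (contDiffOn_succ_iff_fderivWithin hS).1 hF
    set F' : ℝ × E → E →L[ℝ] G := fun p ↦
      (fderivWithin ℝ F (univ ×ˢ u) p) ∘L ContinuousLinearMap.inr ℝ ℝ E with hF'def
    have hF' : ContDiffOn ℝ n F' (univ ×ˢ u) := h.2.2.clm_comp contDiffOn_const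
    have key : ∀ y ∈ u, HasFDerivWithinAt (fun z ↦ ∫ t in a..b, F (t, z))
        (∫ t in a..b, F' (t, y)) u y := fun y hy ↦
      hasFDerivWithinAt_parametric_integral hu hF.continuousOn hF'.continuousOn
        (fun t z hz ↦ hasFDerivWithinAt_slice (h.1 (t, z) ⟨mem_univ _, hz⟩).hasFDerivWithinAt)
        a b hy
    refine (contDiffOn_succ_iff_fderivWithin hu').2
      ⟨fun y hy ↦ (key y hy).differentiableWithinAt, fun h ↦ by simp at h, ?_⟩
    exact (ih hF').congr fun y hy ↦ (key y hy).fderivWithin (hu' y hy)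

theorem contDiffOn_parametric_integral {G : Type u} [NormedAddCommGroup G]
    [NormedSpace ℝ G] [CompleteSpace G] {u : Set E} (hu : Convex ℝ u) (hu' : UniqueDiffOn ℝ u)
    {F : ℝ × E → G} (hF : ContDiffOn ℝ ∞ F (univ ×ˢ u)) (a b : ℝ) :
    ContDiffOn ℝ ∞ (fun y ↦ ∫ t in a..b, F (t, y)) u :=
  contDiffOn_infty.2 fun n ↦ contDiffOn_parametric_integral_nat n hu hu' (contDiffOn_infty.1 hF n)
    a b

end ParametricIntegral

/-! ### The homotopy formula on a product of the real line with a convex set -/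

section HomotopyFormula

open Set MeasureTheory ContinuousAlternatingMap

universe u

variable {E : Type u} [NormedAddCommGroup E] [NormedSpace ℝ E]

variable (E) in
/-- The restriction of an alternating form on `ℝ × E` to the slice `{0} × E`. -/
def restrictSpace (k : ℕ) : ((ℝ × E) [⋀^Fin k]→L[ℝ] ℝ) →L[ℝ] (E [⋀^Fin k]→L[ℝ] ℝ) :=
  compContinuousLinearMapCLM (ContinuousLinearMap.inr ℝ ℝ E)

variable (E) in
/-- The contraction of an alternating form on `ℝ × E` with the unit vector `∂ₛ = (1, 0)`, inserted
in the first argument, followed by the restriction to `{0} × E`. -/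
def contractTime (k : ℕ) : ((ℝ × E) [⋀^Fin (k + 1)]→L[ℝ] ℝ) →L[ℝ] (E [⋀^Fin k]→L[ℝ] ℝ) :=
  restrictSpace E k ∘L ContinuousLinearMap.apply ℝ _ ((1 : ℝ), (0 : E)) ∘L
    (curryLeftLI (𝕜 := ℝ) (E := ℝ × E) (F := ℝ) (n := k)).toContinuousLinearMap

@[simp]
theorem restrictSpace_apply {k : ℕ} (η : (ℝ × E) [⋀^Fin k]→L[ℝ] ℝ) (v : Fin k → E) :
    restrictSpace E k η v = η fun i ↦ (0, v i) := rfl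

@[simp]
theorem contractTime_apply {k : ℕ} (η : (ℝ × E) [⋀^Fin (k + 1)]→L[ℝ] ℝ) (v : Fin k → E) :
    contractTime E k η v = η (Matrix.vecCons (1, 0) fun i ↦ (0, v i)) := rfl

/-- Cartan's formula `ι d = L - d ι` for the constant vector field `(1, 0)`, at the level of the
derivative `D` of a form of positive degree at a point. -/
theorem contractTime_alternatizeUncurryFin {k : ℕ}
    (D : (ℝ × E) →L[ℝ] (ℝ × E) [⋀^Fin (k + 1)]→L[ℝ] ℝ) :
    contractTime E (k + 1) (alternatizeUncurryFin D) = restrictSpace E (k + 1) (D (1, 0)) -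
      alternatizeUncurryFin (contractTime E k ∘L D ∘L ContinuousLinearMap.inr ℝ ℝ E) := by
  ext v
  rw [contractTime_apply, alternatizeUncurryFin_apply, Fin.sum_univ_succ,
    ContinuousAlternatingMap.sub_apply, alternatizeUncurryFin_apply, sub_eq_add_neg,
    ← Finset.sum_neg_distrib]
  congr 1
  · simp only [Fin.val_zero, pow_zero, one_smul, Matrix.cons_val_zero]
    rfl
  · refine Finset.sum_congr rfl fun i _ ↦ ?_
    have h : i.succ.removeNth (Matrix.vecCons ((1 : ℝ), (0 : E)) fun i ↦ ((0 : ℝ), v i)) =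
        Matrix.vecCons (1, 0) fun j ↦ (0, i.removeNth v j) := by
      funext j
      refine Fin.cases ?_ (fun j ↦ ?_) j
      · simp [Fin.removeNth]
      · simp [Fin.removeNth]
    rw [h]
    simp [pow_succ]

/-- Cartan's formula `ι d = L` for the constant vector field `(1, 0)` in degree zero. -/
theorem contractTime_alternatizeUncurryFin_zero
    (D : (ℝ × E) →L[ℝ] (ℝ × E) [⋀^Fin 0]→L[ℝ] ℝ) :
    contractTime E 0 (alternatizeUncurryFin D) = restrictSpace E 0 (D (1, 0)) := by
  ext v
  rw [contractTime_apply, alternatizeUncurryFin_apply, Fin.sum_univ_one, restrictSpace_apply]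
  simp only [Fin.val_zero, pow_zero, one_smul, Matrix.cons_val_zero]
  congr 1

variable {u : Set E}

theorem contDiffOn_extDerivWithin {V : Type*} [NormedAddCommGroup V] [NormedSpace ℝ V] {k : ℕ}
    {S : Set V} (hS : UniqueDiffOn ℝ S) {η : V → V [⋀^Fin k]→L[ℝ] ℝ} (hη : ContDiffOn ℝ ∞ η S) :
    ContDiffOn ℝ ∞ (extDerivWithin η S) S := by
  have h := (alternatizeUncurryFinCLM (n := k) ℝ V ℝ).contDiff.comp_contDiffOn (n := ∞)
    (hη.fderivWithin hS (m := ∞) (by simp))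
  refine h.congr fun x _ ↦ ?_
  rw [Function.comp_apply, alternatizeUncurryFinCLM_apply]
  rfl

/-- The fundamental theorem of calculus for the restrictions of a form to the slices. -/
theorem integral_restrictSpace_fderivWithin {k : ℕ} (hu : UniqueDiffOn ℝ u)
    {Ω : ℝ × E → (ℝ × E) [⋀^Fin k]→L[ℝ] ℝ} (hΩ : ContDiffOn ℝ ∞ Ω (univ ×ˢ u)) (a b : ℝ) {y : E}
    (hy : y ∈ u) :
    ∫ t in a..b, restrictSpace E k (fderivWithin ℝ Ω (univ ×ˢ u) (t, y) (1, 0)) =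
      restrictSpace E k (Ω (b, y)) - restrictSpace E k (Ω (a, y)) := by
  have hS : UniqueDiffOn ℝ ((univ : Set ℝ) ×ˢ u) := uniqueDiffOn_univ.prod hu
  have hd : ∀ t : ℝ, HasDerivAt (fun t ↦ restrictSpace E k (Ω (t, y)))
      (restrictSpace E k (fderivWithin ℝ Ω (univ ×ˢ u) (t, y) (1, 0))) t := fun t ↦
    (restrictSpace E k).hasFDerivAt.comp_hasDerivAt t (hasDerivAt_slice hy
      (hΩ.differentiableOn (by simp) (t, y) ⟨mem_univ _, hy⟩).hasFDerivWithinAt)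
  refine intervalIntegral.integral_eq_sub_of_hasDerivAt (fun t _ ↦ hd t) ?_
  have hc : ContinuousOn (fun p ↦ restrictSpace E k (fderivWithin ℝ Ω (univ ×ˢ u) p (1, 0)))
      (univ ×ˢ u) :=
    (restrictSpace E k).continuous.comp_continuousOn
      ((hΩ.continuousOn_fderivWithin hS (by simp)).clm_apply continuousOn_const)
  exact intervalIntegrable_slice hc hy a b

/-- The homotopy formula `d ∫ₐᵇ ι_{∂ₛ} Ω + ∫ₐᵇ ι_{∂ₛ} dΩ = Ω|_{s = b} - Ω|_{s = a}`. -/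
theorem extDerivWithin_integral_contractTime {k : ℕ} (hc : Convex ℝ u) (hu : UniqueDiffOn ℝ u)
    {Ω : ℝ × E → (ℝ × E) [⋀^Fin (k + 1)]→L[ℝ] ℝ} (hΩ : ContDiffOn ℝ ∞ Ω (univ ×ˢ u)) (a b : ℝ)
    {y : E} (hy : y ∈ u) :
    extDerivWithin (fun z ↦ ∫ t in a..b, contractTime E k (Ω (t, z))) u y +
        ∫ t in a..b, contractTime E (k + 1) (extDerivWithin Ω (univ ×ˢ u) (t, y)) =
      restrictSpace E (k + 1) (Ω (b, y)) - restrictSpace E (k + 1) (Ω (a, y)) := by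
  have hS : UniqueDiffOn ℝ ((univ : Set ℝ) ×ˢ u) := uniqueDiffOn_univ.prod hu
  have hcD : ContinuousOn (fderivWithin ℝ Ω (univ ×ˢ u)) (univ ×ˢ u) :=
    hΩ.continuousOn_fderivWithin hS (by simp)
  -- the partial derivative of the integrand in the direction of the slice
  let F' : ℝ × E → E →L[ℝ] E [⋀^Fin k]→L[ℝ] ℝ := fun p ↦
    contractTime E k ∘L fderivWithin ℝ Ω (univ ×ˢ u) p ∘L ContinuousLinearMap.inr ℝ ℝ E
  have hF' : ContinuousOn F' (univ ×ˢ u) :=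
    continuousOn_const.clm_comp (hcD.clm_comp continuousOn_const)
  have hd : ∀ t, ∀ z ∈ u, HasFDerivWithinAt (fun z ↦ contractTime E k (Ω (t, z))) (F' (t, z)) u z :=
    fun t z hz ↦ (contractTime E k).hasFDerivAt.comp_hasFDerivWithinAt z (hasFDerivWithinAt_slice
      (hΩ.differentiableOn (by simp) (t, z) ⟨mem_univ _, hz⟩).hasFDerivWithinAt)
  have h1 := hasFDerivWithinAt_parametric_integral (F := fun p ↦ contractTime E k (Ω p)) hc
    ((contractTime E k).continuous.comp_continuousOn hΩ.continuousOn) hF' hd a b hy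
  have h2 : extDerivWithin (fun z ↦ ∫ t in a..b, contractTime E k (Ω (t, z))) u y =
      ∫ t in a..b, alternatizeUncurryFin (F' (t, y)) := by
    rw [extDerivWithin, h1.fderivWithin (hu y hy)]
    have h3 := ContinuousLinearMap.intervalIntegral_comp_comm (𝕜 := ℝ)
      (E := E →L[ℝ] E [⋀^Fin k]→L[ℝ] ℝ) (F := E [⋀^Fin (k + 1)]→L[ℝ] ℝ)
      (alternatizeUncurryFinCLM (n := k) ℝ E ℝ)
      (intervalIntegrable_slice (G := E →L[ℝ] E [⋀^Fin k]→L[ℝ] ℝ) hF' hy a b)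
    simp only [alternatizeUncurryFinCLM_apply] at h3
    exact h3.symm
  have hI1 : IntervalIntegrable (fun t ↦ alternatizeUncurryFin (F' (t, y))) volume a b :=
    intervalIntegrable_slice (F := fun p ↦ alternatizeUncurryFin (F' p))
      ((alternatizeUncurryFinCLM (n := k) ℝ E ℝ).continuous.comp_continuousOn hF') hy a b
  have hI2 : IntervalIntegrable
      (fun t ↦ contractTime E (k + 1) (extDerivWithin Ω (univ ×ˢ u) (t, y))) volume a b :=
    intervalIntegrable_slice (F := fun p ↦ contractTime E (k + 1) (extDerivWithin Ω (univ ×ˢ u) p))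
      ((contractTime E (k + 1)).continuous.comp_continuousOn
        (contDiffOn_extDerivWithin hS hΩ).continuousOn) hy a b
  rw [h2, ← intervalIntegral.integral_add hI1 hI2,
    ← integral_restrictSpace_fderivWithin hu hΩ a b hy]
  congr 1
  funext t
  rw [extDerivWithin, contractTime_alternatizeUncurryFin]
  exact add_sub_cancel _ _

/-- The homotopy formula for functions: `∫ₐᵇ ι_{∂ₛ} dΩ = Ω|_{s = b} - Ω|_{s = a}`. -/
theorem integral_contractTime_extDerivWithin_zero (hu : UniqueDiffOn ℝ u)
    {Ω : ℝ × E → (ℝ × E) [⋀^Fin 0]→L[ℝ] ℝ} (hΩ : ContDiffOn ℝ ∞ Ω (univ ×ˢ u)) (a b : ℝ)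
    {y : E} (hy : y ∈ u) :
    ∫ t in a..b, contractTime E 0 (extDerivWithin Ω (univ ×ˢ u) (t, y)) =
      restrictSpace E 0 (Ω (b, y)) - restrictSpace E 0 (Ω (a, y)) := by
  rw [← integral_restrictSpace_fderivWithin hu hΩ a b hy]
  simp only [extDerivWithin, contractTime_alternatizeUncurryFin_zero]

end HomotopyFormula

/-! ### Pullback of forms along parametrized subsets -/

section PullbackWithin

open Set Filter

variable {E : Type*} [NormedAddCommGroup E] [NormedSpace ℝ E]
  {H : Type*} [TopologicalSpace H] {I : ModelWithCorners ℝ E H}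
  {N : Type*} [TopologicalSpace N] [ChartedSpace H N]
  {V : Type*} [NormedAddCommGroup V] [NormedSpace ℝ V]

/-- The pullback of a form `α` on `N` along a map `f` from a subset `S` of a normed space. For `f`
the inverse of a chart this is `chartRep`. -/
def pullbackWithin {k : ℕ} (f : V → N) (S : Set V) (α : ∀ x : N, FormAt I k x) (z : V) :
    V [⋀^Fin k]→L[ℝ] ℝ :=
  (α (f z)).compContinuousLinearMap (mfderivWithin 𝓘(ℝ, V) I f S z)

theorem pullbackWithin_apply {k : ℕ} (f : V → N) (S : Set V) (α : ∀ x : N, FormAt I k x) (z : V)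
    (v : Fin k → V) :
    pullbackWithin f S α z v = α (f z) fun i ↦ mfderivWithin 𝓘(ℝ, V) I f S z (v i) := rfl

theorem pullbackWithin_eq_zero {k : ℕ} {f : V → N} {S : Set V} {α : ∀ x : N, FormAt I k x} {z : V}
    (h : α (f z) = 0) : pullbackWithin f S α z = 0 := by
  ext v
  rw [pullbackWithin_apply, h]
  rfl

variable [IsManifold I ∞ N] {f : V → N} {S : Set V} {z : V}

theorem contDiffWithinAt_extChartAt_comp {q : N} (hf : ContMDiffWithinAt 𝓘(ℝ, V) I ∞ f S z)
    (hq : f z ∈ (extChartAt I q).source) :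
    ContDiffWithinAt ℝ ∞ (extChartAt I q ∘ f) S z :=
  ((contMDiffAt_extChartAt' (by simpa using hq)).comp_contMDiffWithinAt z hf).contDiffWithinAt

/-- In the chart around `q`, a pullback is a pullback between normed spaces. -/
theorem pullbackWithin_eventuallyEq {k : ℕ} (α : ∀ x : N, FormAt I k x) (q : N)
    (hS : UniqueDiffOn ℝ S) (hz : z ∈ S) (hf : ∀ᶠ w in 𝓝[S] z, ContMDiffWithinAt 𝓘(ℝ, V) I ∞ f S w)
    (hq : f z ∈ (extChartAt I q).source) :
    pullbackWithin f S α =ᶠ[𝓝[S] z] fun w ↦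
      (chartRep I α q ((extChartAt I q ∘ f) w)).compContinuousLinearMap
        (fderivWithin ℝ (extChartAt I q ∘ f) S w) := by
  have hfz := hf.self_of_nhdsWithin hz
  have hq' : ∀ᶠ w in 𝓝[S] z, f w ∈ (extChartAt I q).source :=
    hfz.continuousWithinAt.eventually_mem ((isOpen_extChartAt_source q).mem_nhds hq)
  filter_upwards [hf, hq', eventually_eventually_nhdsWithin.2 hq', self_mem_nhdsWithin]
    with w hfw hw hw' hwS
  have hinv : (extChartAt I q).symm ((extChartAt I q ∘ f) w) = f w := (extChartAt I q).left_inv hw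
  have hev : f =ᶠ[𝓝[S] w] (extChartAt I q).symm ∘ (extChartAt I q ∘ f) := by
    filter_upwards [hw'] with x hx
    exact ((extChartAt I q).left_inv hx).symm
  have hU : UniqueMDiffWithinAt 𝓘(ℝ, V) S w := (hS w hwS).uniqueMDiffWithinAt
  have hcomp : ∀ v : V, mfderivWithin 𝓘(ℝ, V) I f S w v =
      mfderivWithin 𝓘(ℝ, E) I (extChartAt I q).symm (range I) ((extChartAt I q ∘ f) w)
        (fderivWithin ℝ (extChartAt I q ∘ f) S w v) := by
    intro v
    have h1 := hev.mfderivWithin_eq (I := 𝓘(ℝ, V)) (I' := I) (hev.self_of_nhdsWithin hwS)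
    have h2 := mfderivWithin_comp (I := 𝓘(ℝ, V)) (I' := 𝓘(ℝ, E)) (I'' := I) w
      (g := (extChartAt I q).symm) (f := extChartAt I q ∘ f) (s := S) (u := range I)
      (mdifferentiableWithinAt_extChartAt_symm ((extChartAt I q).map_source hw))
      ((contDiffWithinAt_extChartAt_comp hfw hw).differentiableWithinAt
        (by simp)).mdifferentiableWithinAt
      (fun x _ ↦ mem_range_self _) hU
    rw [mfderivWithin_eq_fderivWithin] at h2
    exact (DFunLike.congr_fun h1 v).trans (DFunLike.congr_fun h2 v)
  ext v
  rw [pullbackWithin_apply, ContinuousAlternatingMap.compContinuousLinearMap_apply, chartRep_apply]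
  refine Eq.trans ?_ (FormAt.congr_point I α hinv _).symm
  exact congrArg (α _) (funext fun i ↦ hcomp (v i))

theorem contDiffWithinAt_pullbackWithin {k : ℕ} (α : Form I N k) (hS : UniqueDiffOn ℝ S)
    (hz : z ∈ S) (hf : ∀ᶠ w in 𝓝[S] z, ContMDiffWithinAt 𝓘(ℝ, V) I ∞ f S w) :
    ContDiffWithinAt ℝ ∞ (pullbackWithin f S α) S z := by
  have h := pullbackWithin_eventuallyEq (α : ∀ x : N, FormAt I k x) (f z) hS hz hf
    (mem_extChartAt_source _)
  refine ContDiffWithinAt.congr_of_eventuallyEq ?_ h (h.self_of_nhdsWithin hz)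
  have hf' := contDiffWithinAt_extChartAt_comp (hf.self_of_nhdsWithin hz)
    (mem_extChartAt_source (I := I) (f z))
  refine (contDiff_compContinuousLinearMap k).contDiffAt.comp_contDiffWithinAt z
    (ContDiffWithinAt.prodMk ?_ ?_)
  · exact ContDiffWithinAt.comp (t := range I) z (contDiffWithinAt_chartRep_self α (f z)) hf'
      (fun w _ ↦ mem_range_self _)
  · exact hf'.fderivWithin_right hS (by simp) hz

/-- The exterior derivative commutes with pullback. -/
theorem extDerivWithin_pullbackWithin {k : ℕ} (α : Form I N k) (hS : UniqueDiffOn ℝ S)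
    (hz : z ∈ S) (hz' : z ∈ closure (interior S))
    (hf : ∀ᶠ w in 𝓝[S] z, ContMDiffWithinAt 𝓘(ℝ, V) I ∞ f S w) :
    extDerivWithin (pullbackWithin f S α) S z = pullbackWithin f S (extDerivForm I α) z := by
  have hq := mem_extChartAt_source (I := I) (f z)
  have h := pullbackWithin_eventuallyEq (α : ∀ x : N, FormAt I k x) (f z) hS hz hf hq
  have h' := (pullbackWithin_eventuallyEq (extDerivForm I α : ∀ x : N, FormAt I (k + 1) x) (f z)
    hS hz hf hq).self_of_nhdsWithin hz
  have hf' := contDiffWithinAt_extChartAt_comp (hf.self_of_nhdsWithin hz) hq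
  rw [h.extDerivWithin_eq (h.self_of_nhdsWithin hz), h']
  have hd : DifferentiableWithinAt ℝ (chartRep I α (f z)) (range I) ((extChartAt I (f z) ∘ f) z) :=
    (contDiffWithinAt_chartRep_self α (f z)).differentiableWithinAt (by simp)
  refine (extDerivWithin_pullback (t := range I) hd hf' two_le_infty hS hz' hz
    (fun w _ ↦ mem_range_self _)).trans ?_
  exact congrArg (fun ξ : E [⋀^Fin (k + 1)]→L[ℝ] ℝ ↦
    ξ.compContinuousLinearMap (fderivWithin ℝ (extChartAt I (f z) ∘ f) S z)) <|
     (chartRep_extDerivAt α (f z) (mem_extChartAt_target (f z))).symm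

theorem FormAt.eq_of_chartRep_eq {k : ℕ} {α β : ∀ x : N, FormAt I k x} {x : N}
    (h : chartRep I α x (extChartAt I x x) = chartRep I β x (extChartAt I x x)) : α x = β x := by
  have hx := extChartAt_to_inv (I := I) x
  have : IsManifold I 1 N := IsManifold.of_le (n := ∞) (by simp)
  ext v
  have hid := mfderivWithin_extChartAt_symm_comp_mfderiv_extChartAt (I := I)
    (mem_extChartAt_target x)
  have hv : ∀ w : E, mfderivWithin 𝓘(ℝ, E) I (extChartAt I x).symm (range I) (extChartAt I x x)
      (mfderiv I 𝓘(ℝ, E) (extChartAt I x) ((extChartAt I x).symm (extChartAt I x x)) w) = w :=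
    fun w ↦ DFunLike.congr_fun hid w
  have h1 := DFunLike.congr_fun h fun i ↦
    mfderiv I 𝓘(ℝ, E) (extChartAt I x) ((extChartAt I x).symm (extChartAt I x x)) (v i)
  have key : ∀ γ : ∀ x : N, FormAt I k x, γ ((extChartAt I x).symm (extChartAt I x x)) (fun i ↦
      mfderivWithin 𝓘(ℝ, E) I (extChartAt I x).symm (range I) (extChartAt I x x)
      (mfderiv I 𝓘(ℝ, E) (extChartAt I x) ((extChartAt I x).symm (extChartAt I x x)) (v i))) =
      γ x v := fun γ ↦ by
    refine Eq.trans ?_ (FormAt.congr_point I γ hx v)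
    exact congrArg (γ _) (funext fun i ↦ hv (v i))
  exact (key α).symm.trans (h1.trans (key β))

end PullbackWithin

/-! ### Proper actions of the real line -/

section Proper

open Set Filter

variable {N : Type*} [TopologicalSpace N] [AddAction ℝ N] [ProperVAdd ℝ N]

/-- By properness, near `p₀` the orbits are outside a compact set for all large times, uniformly in
the starting point. -/
theorem exists_vadd_notMem_of_isCompact [LocallyCompactSpace N] {K : Set N} (hK : IsCompact K)
    (p₀ : N) : ∃ R : ℝ, ∀ᶠ p in 𝓝 p₀, ∀ t : ℝ, R < |t| → t +ᵥ p ∉ K := by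
  obtain ⟨C, hC, hCp⟩ := exists_compact_mem_nhds p₀
  have h := (ProperVAdd.isProperMap_vadd_pair (G := ℝ) (X := N)).isCompact_preimage (hK.prod hC)
  obtain ⟨R, hR⟩ := (h.image continuous_fst).isBounded.exists_norm_le
  refine ⟨R, ?_⟩
  filter_upwards [hCp] with p hp t ht hmem
  exact ht.not_ge (hR t ⟨(t, p), ⟨hmem, hp⟩, rfl⟩)

theorem isClosed_image_vadd_of_isCompact [T2Space N] {K : Set N} (hK : IsCompact K) {T : Set ℝ}
    (hT : IsClosed T) : IsClosed {q : N | ∃ p ∈ K, ∃ s ∈ T, q = s +ᵥ p} := by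
  have h1 : IsClosed ((fun gx : ℝ × N ↦ (gx.1 +ᵥ gx.2, gx.2)) '' (T ×ˢ K)) :=
    ProperVAdd.isProperMap_vadd_pair.isClosedMap _ (hT.prod hK.isClosed)
  have : CompactSpace K := isCompact_iff_compactSpace.1 hK
  have h2 := isClosedMap_fst_of_compactSpace (X := N) (Y := K) _
    (h1.preimage (f := fun z : N × K ↦ (z.1, (z.2 : N))) (by fun_prop))
  convert h2 using 1
  ext q
  constructor
  · rintro ⟨p, hp, s, hs, rfl⟩
    exact ⟨(s +ᵥ p, ⟨p, hp⟩), ⟨(s, p), ⟨hs, hp⟩, rfl⟩, rfl⟩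
  · rintro ⟨⟨q', p'⟩, ⟨⟨s, p⟩, ⟨hs, hp⟩, he⟩, rfl⟩
    exact ⟨p, hp, s, hs, (congrArg Prod.fst he).symm⟩

end Proper

/-! ### The flow in a chart -/

section Flow

open Set Filter

variable {E : Type*} [NormedAddCommGroup E] [NormedSpace ℝ E]
  {H : Type*} [TopologicalSpace H] (I : ModelWithCorners ℝ E H)
  {N : Type*} [TopologicalSpace N] [ChartedSpace H N] [AddAction ℝ N]

/-- The action map `ℝ × N → N` in the chart around `x₀` of the source, `(s, y) ↦ Θ(s, ψ⁻¹ y)`. -/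
def flowBox (x₀ : N) (z : ℝ × E) : N := z.1 +ᵥ (extChartAt I x₀).symm z.2

/-- The contraction of `Θ^*α` at `(s, p)` with `∂ₛ`, restricted to `TₚN`: the integrand of the
fiber integral. It has values in the fixed space of forms on `E`, so that it can be integrated. -/
def flowContract {k : ℕ} (α : ∀ p : N, FormAt I (k + 1) p) (s : ℝ) (p : N) : E [⋀^Fin k]→L[ℝ] ℝ :=
  contractTime E k (actionPullback I α (s, p) : (ℝ × E) [⋀^Fin (k + 1)]→L[ℝ] ℝ)

variable {I}

theorem flowContract_apply {k : ℕ} (α : ∀ p : N, FormAt I (k + 1) p) (s : ℝ) (p : N)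
    (v : Fin k → E) :
    flowContract I α s p v = actionPullback I α (s, p)
      (Matrix.vecCons ((1 : ℝ), (0 : E)) fun i ↦ ((0 : ℝ), v i)) := rfl

theorem flowContract_eq_zero {k : ℕ} {α : ∀ p : N, FormAt I (k + 1) p} {s : ℝ} {p : N}
    (h : α (s +ᵥ p) = 0) : flowContract I α s p = 0 := by
  have h1 : actionPullback I α (s, p) = 0 := by
    ext v
    exact DFunLike.congr_fun h _
  ext v
  rw [flowContract_apply, h1]
  rfl

variable [IsManifold I ∞ N] [ContMDiffVAdd 𝓘(ℝ, ℝ) I ∞ ℝ N]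

theorem contMDiffWithinAt_flowBox (x₀ : N) {z : ℝ × E} (hz : z.2 ∈ (extChartAt I x₀).target) :
    ContMDiffWithinAt 𝓘(ℝ, ℝ × E) I ∞ (flowBox I x₀) (univ ×ˢ range I) z := by
  have h1 : ContMDiffWithinAt 𝓘(ℝ, ℝ × E) 𝓘(ℝ, ℝ) ∞ (Prod.fst : ℝ × E → ℝ) (univ ×ˢ range I) z :=
    contDiff_fst.contDiffWithinAt.contMDiffWithinAt
  have h2 : ContMDiffWithinAt 𝓘(ℝ, ℝ × E) I ∞ (fun w : ℝ × E ↦ (extChartAt I x₀).symm w.2)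
      (univ ×ˢ range I) z :=
    (contMDiffWithinAt_extChartAt_symm_range (n := ∞) x₀ hz).comp z
      contDiff_snd.contDiffWithinAt.contMDiffWithinAt fun w hw ↦ hw.2
  exact (contMDiff_vadd (I := 𝓘(ℝ, ℝ)) (I' := I) (n := ∞) (G := ℝ) (M := N)
    |>.contMDiffAt).comp_contMDiffWithinAt z (h1.prodMk h2)

theorem eventually_contMDiffWithinAt_flowBox (x₀ : N) {z : ℝ × E}
    (hz : z.2 ∈ (extChartAt I x₀).target) :
    ∀ᶠ w in 𝓝[univ ×ˢ range I] z,
      ContMDiffWithinAt 𝓘(ℝ, ℝ × E) I ∞ (flowBox I x₀) (univ ×ˢ range I) w := by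
  have h : ∀ᶠ w : ℝ × E in 𝓝[univ ×ˢ range I] z, w.2 ∈ (extChartAt I x₀).target := by
    have ht : Tendsto Prod.snd (𝓝[univ ×ˢ range I] z) (𝓝[range I] z.2) :=
      continuousWithinAt_snd.tendsto_nhdsWithin fun w hw ↦ hw.2
    exact ht.eventually (extChartAt_target_mem_nhdsWithin_of_mem hz)
  exact h.mono fun w hw ↦ contMDiffWithinAt_flowBox x₀ hw

theorem uniqueDiffOn_univ_prod_range : UniqueDiffOn ℝ ((univ : Set ℝ) ×ˢ range I) :=
  uniqueDiffOn_univ.prod I.uniqueDiffOn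

theorem contDiffWithinAt_pullbackWithin_flowBox {k : ℕ} (α : Form I N k) (x₀ : N) {z : ℝ × E}
    (hz : z.2 ∈ (extChartAt I x₀).target) :
    ContDiffWithinAt ℝ ∞ (pullbackWithin (flowBox I x₀) (univ ×ˢ range I) α) (univ ×ˢ range I) z :=
  contDiffWithinAt_pullbackWithin α uniqueDiffOn_univ_prod_range
    ⟨mem_univ _, extChartAt_target_subset_range x₀ hz⟩ (eventually_contMDiffWithinAt_flowBox x₀ hz)

theorem extDerivWithin_pullbackWithin_flowBox {k : ℕ} (α : Form I N k) (x₀ : N) {z : ℝ × E}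
    (hz : z.2 ∈ (extChartAt I x₀).target) :
    extDerivWithin (pullbackWithin (flowBox I x₀) (univ ×ˢ range I) α) (univ ×ˢ range I) z =
      pullbackWithin (flowBox I x₀) (univ ×ˢ range I) (extDerivForm I α) z := by
  have hzr := extChartAt_target_subset_range x₀ hz
  refine extDerivWithin_pullbackWithin α uniqueDiffOn_univ_prod_range
    ⟨mem_univ _, hzr⟩ ?_ (eventually_contMDiffWithinAt_flowBox x₀ hz)
  rw [interior_prod_eq, closure_prod_eq, interior_univ, closure_univ]
  exact ⟨mem_univ _, I.range_subset_closure_interior hzr⟩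

/-- The chain rule for `flowBox`: the differential of the action after that of `id × ψ⁻¹`. -/
theorem hasMFDerivWithinAt_flowBox (x₀ : N) {z : ℝ × E} (hz : z.2 ∈ (extChartAt I x₀).target) :
    HasMFDerivWithinAt 𝓘(ℝ, ℝ × E) I (flowBox I x₀) (univ ×ˢ range I) z
      ((mfderiv (𝓘(ℝ, ℝ).prod I) I (fun w : ℝ × N ↦ w.1 +ᵥ w.2)
          (z.1, (extChartAt I x₀).symm z.2)) ∘L
        (ContinuousLinearMap.fst ℝ ℝ E).prod
          ((mfderivWithin 𝓘(ℝ, E) I (extChartAt I x₀).symm (range I) z.2) ∘L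
            ContinuousLinearMap.snd ℝ ℝ E)) := by
  have : IsManifold I 1 N := IsManifold.of_le (n := ∞) (by simp)
  have h1 : HasMFDerivWithinAt 𝓘(ℝ, ℝ × E) 𝓘(ℝ, ℝ) (Prod.fst : ℝ × E → ℝ) (univ ×ˢ range I) z
      (ContinuousLinearMap.fst ℝ ℝ E) := hasFDerivWithinAt_fst.hasMFDerivWithinAt
  have h2 : HasMFDerivWithinAt 𝓘(ℝ, ℝ × E) 𝓘(ℝ, E) (Prod.snd : ℝ × E → E) (univ ×ˢ range I) z
      (ContinuousLinearMap.snd ℝ ℝ E) := hasFDerivWithinAt_snd.hasMFDerivWithinAt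
  have h3 := (mdifferentiableWithinAt_extChartAt_symm hz).hasMFDerivWithinAt.comp z h2
    fun w hw ↦ hw.2
  have h4 := ((contMDiff_vadd (I := 𝓘(ℝ, ℝ)) (I' := I) (n := ∞) (G := ℝ) (M := N)).mdifferentiable
    (by simp) (z.1, (extChartAt I x₀).symm z.2)).hasMFDerivAt
  exact HasMFDerivAt.comp_hasMFDerivWithinAt
    (f := fun w : ℝ × E ↦ (w.1, (extChartAt I x₀).symm w.2)) z h4 (h1.prodMk h3)

theorem mfderivWithin_flowBox_apply (x₀ : N) {t : ℝ} {y : E} (hy : y ∈ (extChartAt I x₀).target)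
    (w : ℝ × E) :
    mfderivWithin 𝓘(ℝ, ℝ × E) I (flowBox I x₀) (univ ×ˢ range I) (t, y) w =
      mfderiv (𝓘(ℝ, ℝ).prod I) I (fun w : ℝ × N ↦ w.1 +ᵥ w.2) (t, (extChartAt I x₀).symm y)
        (w.1, mfderivWithin 𝓘(ℝ, E) I (extChartAt I x₀).symm (range I) y w.2) := by
  have hU : UniqueMDiffWithinAt 𝓘(ℝ, ℝ × E) (univ ×ˢ range I) (t, y) :=
    (uniqueDiffOn_univ_prod_range (t, y)
      ⟨mem_univ _, extChartAt_target_subset_range x₀ hy⟩).uniqueMDiffWithinAt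
  exact DFunLike.congr_fun ((hasMFDerivWithinAt_flowBox x₀ (z := (t, y)) hy).mfderivWithin hU) w

/-- The local integrand is the chart representative of the global one. -/
theorem contractTime_pullbackWithin_flowBox {k : ℕ} (α : ∀ p : N, FormAt I (k + 1) p) (x₀ : N)
    (t : ℝ) {y : E} (hy : y ∈ (extChartAt I x₀).target) :
    contractTime E k (pullbackWithin (flowBox I x₀) (univ ×ˢ range I) α (t, y)) =
      chartRep I (flowContract I α t : ∀ p : N, FormAt I k p) x₀ y := by
  ext v
  rw [contractTime_apply, pullbackWithin_apply]
  refine congrArg (α (t +ᵥ (extChartAt I x₀).symm y)) (funext fun i ↦ ?_)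
  refine (mfderivWithin_flowBox_apply x₀ hy _).trans ?_
  refine congrArg (mfderiv (𝓘(ℝ, ℝ).prod I) I (fun w : ℝ × N ↦ w.1 +ᵥ w.2)
    (t, (extChartAt I x₀).symm y)) ?_
  refine Fin.cases ?_ (fun i ↦ ?_) i
  · exact Prod.ext rfl (map_zero _)
  · rfl

/-- At time zero, the local form restricts to the chart representative. -/
theorem restrictSpace_pullbackWithin_flowBox_zero {k : ℕ} (α : ∀ p : N, FormAt I k p) (x₀ : N)
    {y : E} (hy : y ∈ (extChartAt I x₀).target) :
    restrictSpace E k (pullbackWithin (flowBox I x₀) (univ ×ˢ range I) α (0, y)) =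
      chartRep I α x₀ y := by
  have : IsManifold I 1 N := IsManifold.of_le (n := ∞) (by simp)
  have hyr := extChartAt_target_subset_range x₀ hy
  have h0 : ∀ w : E, flowBox I x₀ (0, w) = (extChartAt I x₀).symm w := fun w ↦ zero_vadd _ _
  have hD : ∀ w : E, mfderivWithin 𝓘(ℝ, ℝ × E) I (flowBox I x₀) (univ ×ˢ range I) (0, y) (0, w) =
      mfderivWithin 𝓘(ℝ, E) I (extChartAt I x₀).symm (range I) y w := by
    intro w
    have h1 : HasMFDerivWithinAt 𝓘(ℝ, E) 𝓘(ℝ, ℝ × E) (fun w : E ↦ ((0 : ℝ), w)) (range I) y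
        (ContinuousLinearMap.inr ℝ ℝ E) :=
      (hasFDerivAt_prodMk_right (0 : ℝ) y).hasFDerivWithinAt.hasMFDerivWithinAt
    have h2 := (((contMDiffWithinAt_flowBox x₀ (z := ((0 : ℝ), y)) hy).mdifferentiableWithinAt
      (by simp)).hasMFDerivWithinAt.comp y h1 fun w hw ↦ ⟨mem_univ _, hw⟩)
    have h3 := h2.mfderivWithin (I.uniqueDiffOn y hyr).uniqueMDiffWithinAt
    have h4 : flowBox I x₀ ∘ (fun w : E ↦ ((0 : ℝ), w)) = (extChartAt I x₀).symm := funext h0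
    rw [h4] at h3
    exact (DFunLike.congr_fun h3 w).symm
  ext v
  rw [restrictSpace_apply, pullbackWithin_apply, chartRep_apply]
  refine Eq.trans ?_ (FormAt.congr_point I α (h0 y) _)
  exact congrArg (α _) (funext fun i ↦ hD (v i))

/-- Continuity in `t` is read off in the chart around `p`, as the differential of this chart is
invertible at `p`. -/
theorem continuous_flowContract {k : ℕ} (α : Form I N (k + 1)) (p : N) :
    Continuous fun t ↦ flowContract I α t p := by
  have : IsManifold I 1 N := IsManifold.of_le (n := ∞) (by simp)
  set y := extChartAt I p p with hydef
  have hy : y ∈ (extChartAt I p).target := mem_extChartAt_target p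
  have hyp : (extChartAt I p).symm y = p := extChartAt_to_inv p
  let D : E →L[ℝ] E := mfderiv I 𝓘(ℝ, E) (extChartAt I p) ((extChartAt I p).symm y)
  have hD : ∀ w : E, mfderivWithin 𝓘(ℝ, E) I (extChartAt I p).symm (range I) y (D w) = w :=
    fun w ↦ DFunLike.congr_fun (mfderivWithin_extChartAt_symm_comp_mfderiv_extChartAt (I := I) hy) w
  have hc : Continuous fun t : ℝ ↦
      pullbackWithin (flowBox I p) (univ ×ˢ range I) α (t, y) := by
    refine continuousOn_univ.1 (ContinuousOn.comp (t := univ ×ˢ {y})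
      (g := pullbackWithin (flowBox I p) (univ ×ˢ range I) α) ?_ (by fun_prop)
      fun t _ ↦ ⟨mem_univ _, rfl⟩)
    rintro ⟨t, z⟩ ⟨-, rfl⟩
    exact (contDiffWithinAt_pullbackWithin_flowBox α p (z := (t, y)) hy).continuousWithinAt.mono
      (prod_mono_right (singleton_subset_iff.2 (extChartAt_target_subset_range p hy)))
  have h1 : (fun t ↦ flowContract I α t p) = fun t ↦
      ContinuousAlternatingMap.compContinuousLinearMapCLM D (contractTime E k
        (pullbackWithin (flowBox I p) (univ ×ˢ range I) α (t, y))) := by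
    funext t
    rw [contractTime_pullbackWithin_flowBox (α : ∀ p : N, FormAt I (k + 1) p) p t hy]
    ext v
    have h2 : flowContract I α t ((extChartAt I p).symm y) v = flowContract I α t p v := by
      rw [hyp]
    refine h2.symm.trans ?_
    exact congrArg (flowContract I α t ((extChartAt I p).symm y)) (funext fun i ↦ (hD (v i)).symm)
  rw [h1]
  exact (ContinuousLinearMap.continuous _).comp ((contractTime E k).continuous.comp hc)

end Flow

/-! ### Integration along the orbits -/

section SignedHalfLine

open Set MeasureTheory

/-- The half-lines of integration with their signs: `ℝ^{≤0}` with the sign `+1` (the forward case)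
and `ℝ^{≥0}` with the sign `-1` (the backward case). -/
def IsSignedHalfLine (S : Set ℝ) (ε : ℝ) : Prop := S = Iic 0 ∧ ε = 1 ∨ S = Ici 0 ∧ ε = -1

/-- In both cases the signed integral is an oriented integral ending at zero. The other endpoint
`-ε (|R| + 1)` is a point of `S` beyond the support of the integrand, on the far side of `±R`. -/
theorem IsSignedHalfLine.smul_integral_eq {S : Set ℝ} {ε : ℝ} (h : IsSignedHalfLine S ε)
    {G : Type*} [NormedAddCommGroup G] [NormedSpace ℝ G] {f : ℝ → G} {R : ℝ}
    (hf : ∀ t, R < |t| → f t = 0) :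
    ε • ∫ t in S, f t = ∫ t in (-ε * (|R| + 1))..0, f t := by
  have hR : R ≤ |R| := le_abs_self R
  have hR0 : 0 ≤ |R| := abs_nonneg R
  rcases h with ⟨rfl, rfl⟩ | ⟨rfl, rfl⟩
  · rw [intervalIntegral.integral_of_le (by linarith), one_smul]
    refine setIntegral_eq_of_subset_of_forall_sdiff_eq_zero measurableSet_Iic
      (fun t ht ↦ ht.2) fun t ht ↦ hf t ?_
    have h1 : t ≤ 0 := ht.1
    have h2 : t ≤ -1 * (|R| + 1) := by
      by_contra hlt
      exact ht.2 ⟨not_le.1 hlt, h1⟩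
    rw [abs_of_nonpos h1]
    linarith
  · rw [intervalIntegral.integral_symm, intervalIntegral.integral_of_le (by linarith),
      integral_Ici_eq_integral_Ioi, neg_smul, one_smul]
    congr 1
    refine setIntegral_eq_of_subset_of_forall_sdiff_eq_zero measurableSet_Ioi
      (fun t ht ↦ ht.1) fun t ht ↦ hf t ?_
    have h1 : 0 < t := ht.1
    have h2 : - -1 * (|R| + 1) < t := by
      by_contra hle
      exact ht.2 ⟨h1, not_lt.1 hle⟩
    rw [abs_of_pos h1]
    linarith

theorem IsSignedHalfLine.lt_abs {S : Set ℝ} {ε : ℝ} (h : IsSignedHalfLine S ε) (R : ℝ) :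
    R < |-ε * (|R| + 1)| := by
  have h1 : |ε| = 1 := by rcases h with ⟨-, rfl⟩ | ⟨-, rfl⟩ <;> simp
  rw [abs_mul, abs_neg, h1, one_mul, abs_of_nonneg (by positivity)]
  linarith [le_abs_self R]

end SignedHalfLine

theorem eq_zero_of_notMem_support {E : Type*} [NormedAddCommGroup E] [NormedSpace ℝ E]
    {H : Type*} [TopologicalSpace H] {I : ModelWithCorners ℝ E H} {N : Type*} [TopologicalSpace N]
    [ChartedSpace H N] [IsManifold I ∞ N] {k : ℕ} (α : Form I N k) {p : N}
    (hp : p ∉ support I α) : α p = 0 := by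
  by_contra h
  exact hp (subset_closure h)

section Green

open Set Filter MeasureTheory

universe u v w

variable {E : Type u} [NormedAddCommGroup E] [NormedSpace ℝ E]
  {H : Type w} [TopologicalSpace H] {I : ModelWithCorners ℝ E H}
  {N : Type v} [TopologicalSpace N] [ChartedSpace H N] [AddAction ℝ N]

variable (I) in
/-- The form `ε ∫_S Θ^*α`, integrated along the fibers of `ℝ × N → N`. -/
def greenFun {k : ℕ} (S : Set ℝ) (ε : ℝ) (α : ∀ p : N, FormAt I (k + 1) p) (p : N) :
    FormAt I k p :=
  (ε • ∫ t in S, flowContract I α t p : E [⋀^Fin k]→L[ℝ] ℝ)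

/-- In the chart around `x₀` there is a convex neighborhood `u` on which all orbits are outside the
compact set `K` for times beyond a common bound `R`. -/
theorem exists_convex_mem_nhdsWithin [LocallyCompactSpace N] [ProperVAdd ℝ N] {K : Set N}
    (hK : IsCompact K) (x₀ : N) :
    ∃ (R : ℝ) (u : Set E), Convex ℝ u ∧ UniqueDiffOn ℝ u ∧ extChartAt I x₀ x₀ ∈ u ∧
      u ⊆ range I ∧ u ∈ 𝓝[range I] (extChartAt I x₀ x₀) ∧ u ⊆ (extChartAt I x₀).target ∧
      ∀ y ∈ u, ∀ t : ℝ, R < |t| → t +ᵥ (extChartAt I x₀).symm y ∉ K := by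
  obtain ⟨R, hR⟩ := exists_vadd_notMem_of_isCompact hK x₀
  have h1 : ∀ᶠ y in 𝓝[range I] (extChartAt I x₀ x₀), ∀ t : ℝ, R < |t| →
      t +ᵥ (extChartAt I x₀).symm y ∉ K := by
    have h2 := (continuousAt_extChartAt_symm (I := I) x₀).tendsto
    rw [extChartAt_to_inv] at h2
    exact nhdsWithin_le_nhds (h2.eventually hR)
  obtain ⟨r, hr, hsub⟩ := Metric.mem_nhdsWithin_iff.1
    (h1.and (extChartAt_target_mem_nhdsWithin (I := I) x₀))
  refine ⟨R, range I ∩ Metric.ball (extChartAt I x₀ x₀) r,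
    I.convex_range.inter (convex_ball _ _), I.uniqueDiffOn.inter Metric.isOpen_ball,
    ⟨mem_range_self _, Metric.mem_ball_self hr⟩, inter_subset_left,
    inter_mem_nhdsWithin _ (Metric.ball_mem_nhds _ hr),
    fun y hy ↦ (hsub ⟨hy.2, hy.1⟩).2, fun y hy ↦ (hsub ⟨hy.2, hy.1⟩).1⟩

variable [IsManifold I ∞ N]

theorem pullbackWithin_flowBox_eq_zero {k : ℕ} (α : Form I N k) (x₀ : N) {t : ℝ} {y : E}
    (h : t +ᵥ (extChartAt I x₀).symm y ∉ support I α) :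
    pullbackWithin (flowBox I x₀) (univ ×ˢ range I) α (t, y) = 0 :=
  pullbackWithin_eq_zero (eq_zero_of_notMem_support α h)

variable [ContMDiffVAdd 𝓘(ℝ, ℝ) I ∞ ℝ N] {S : Set ℝ} {ε : ℝ}

/-- The chart representative of `ε ∫_S Θ^*α`, at points whose orbit meets the support of `α` only
for times in `[-R, R]`. -/
theorem chartRep_greenFun (hS : IsSignedHalfLine S ε) {k : ℕ} (α : Form I N (k + 1)) (x₀ : N)
    {y : E} (hy : y ∈ (extChartAt I x₀).target) {R : ℝ}
    (hR : ∀ t : ℝ, R < |t| → t +ᵥ (extChartAt I x₀).symm y ∉ support I α) :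
    chartRep I (greenFun I S ε α) x₀ y = ∫ t in (-ε * (|R| + 1))..0,
      contractTime E k (pullbackWithin (flowBox I x₀) (univ ×ˢ range I) α (t, y)) := by
  have h1 : ε • ∫ t in S, flowContract I α t ((extChartAt I x₀).symm y) =
      ∫ t in (-ε * (|R| + 1))..0, flowContract I α t ((extChartAt I x₀).symm y) :=
    hS.smul_integral_eq fun t ht ↦ flowContract_eq_zero (eq_zero_of_notMem_support α (hR t ht))
  let D : E →L[ℝ] E := mfderivWithin 𝓘(ℝ, E) I (extChartAt I x₀).symm (range I) y
  have h2 := (ContinuousAlternatingMap.compContinuousLinearMapCLM (ι := Fin k) (F := ℝ)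
    D).intervalIntegral_comp_comm ((continuous_flowContract α
      ((extChartAt I x₀).symm y)).intervalIntegrable (μ := volume) (-ε * (|R| + 1)) 0)
  have h3 : chartRep I (greenFun I S ε α) x₀ y =
      ContinuousAlternatingMap.compContinuousLinearMapCLM D
        (ε • ∫ t in S, flowContract I α t ((extChartAt I x₀).symm y)) := rfl
  rw [h3, h1, ← h2]
  congr 1
  funext t
  exact (contractTime_pullbackWithin_flowBox (α : ∀ p : N, FormAt I (k + 1) p) x₀ t hy).symm

theorem contDiffOn_pullbackWithin_flowBox {k : ℕ} (α : Form I N k) (x₀ : N) {u : Set E}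
    (hu : u ⊆ range I) (hu' : u ⊆ (extChartAt I x₀).target) :
    ContDiffOn ℝ ∞ (pullbackWithin (flowBox I x₀) (univ ×ˢ range I) α) (univ ×ˢ u) :=
  fun _ hz ↦ (contDiffWithinAt_pullbackWithin_flowBox α x₀ (hu' hz.2)).mono (prod_mono_right hu)

variable [LocallyCompactSpace N] [ProperVAdd ℝ N]

theorem contMDiff_greenFun (hS : IsSignedHalfLine S ε) {k : ℕ} (α : FormC I N (k + 1)) :
    ContMDiff I (I.prod 𝓘(ℝ, E [⋀^Fin k]→L[ℝ] ℝ)) ∞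
      (fun x ↦ Bundle.TotalSpace.mk' (E [⋀^Fin k]→L[ℝ] ℝ) (E := fun x : N ↦ FormAt I k x) x
        (greenFun I S ε α.1 x)) := by
  refine contMDiff_of_chartRep _ fun x₀ ↦ ?_
  obtain ⟨R, u, huc, hud, hy₀, hur, hun, hut, hR⟩ := exists_convex_mem_nhdsWithin (I := I) α.2 x₀
  have h1 : ContDiffOn ℝ ∞ (fun y ↦ ∫ t in (-ε * (|R| + 1))..0, contractTime E k
      (pullbackWithin (flowBox I x₀) (univ ×ˢ range I) α.1 (t, y))) u :=
    contDiffOn_parametric_integral huc hud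
      (F := fun z ↦ contractTime E k (pullbackWithin (flowBox I x₀) (univ ×ˢ range I) α.1 z))
      ((contractTime E k).contDiff.comp_contDiffOn
        (contDiffOn_pullbackWithin_flowBox α.1 x₀ hur hut))
      _ _
  have h2 := h1.congr fun y hy ↦ chartRep_greenFun hS α.1 x₀ (hut hy) (hR y hy)
  exact (h2 _ hy₀).mono_of_mem_nhdsWithin hun

/-- The smooth form `ε ∫_S Θ^*α`. -/
def greenForm (hS : IsSignedHalfLine S ε) {k : ℕ} (α : FormC I N (k + 1)) : Form I N k :=
  ⟨greenFun I S ε α.1, contMDiff_greenFun hS α⟩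

theorem integrable_flowContract {k : ℕ} (α : FormC I N (k + 1)) (p : N) :
    Integrable fun t ↦ flowContract I α.1 t p := by
  obtain ⟨R, hR⟩ := exists_vadd_notMem_of_isCompact α.2 p
  refine (continuous_flowContract α.1 p).integrable_of_hasCompactSupport
    (HasCompactSupport.intro (K := Metric.closedBall 0 R) (isCompact_closedBall _ _) fun t ht ↦
      flowContract_eq_zero (eq_zero_of_notMem_support α.1 (hR.self_of_nhds t ?_)))
  rw [mem_closedBall_zero_iff, Real.norm_eq_abs, not_le] at ht
  exact ht

/-- The linear map `α ↦ ε ∫_S Θ^*α`. -/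
def greenMap (hS : IsSignedHalfLine S ε) (k : ℕ) : FormC I N (k + 1) →ₗ[ℝ] Form I N k where
  toFun := greenForm hS
  map_add' α β := by
    refine ContMDiffSection.ext fun p ↦ ?_
    have h : ∀ t, flowContract I (α + β : FormC I N (k + 1)).1 t p =
        flowContract I α.1 t p + flowContract I β.1 t p := fun t ↦ rfl
    change ε • ∫ t in S, flowContract I (α + β : FormC I N (k + 1)).1 t p =
      ε • (∫ t in S, flowContract I α.1 t p) + ε • ∫ t in S, flowContract I β.1 t p
    simp only [h]
    rw [integral_add (integrable_flowContract α p).integrableOn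
      (integrable_flowContract β p).integrableOn, smul_add]
  map_smul' c α := by
    refine ContMDiffSection.ext fun p ↦ ?_
    have h : ∀ t, flowContract I (c • α : FormC I N (k + 1)).1 t p =
        c • flowContract I α.1 t p := fun t ↦ rfl
    change ε • ∫ t in S, flowContract I (c • α : FormC I N (k + 1)).1 t p =
      c • (ε • ∫ t in S, flowContract I α.1 t p)
    simp only [h]
    rw [integral_smul, smul_comm]

theorem greenMap_apply (hS : IsSignedHalfLine S ε) {k : ℕ} (α : FormC I N (k + 1)) (p : N) :
    greenMap hS k α p = greenFun I S ε α.1 p := rfl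

/-- `greenMap` is, up to the sign `ε`, the fiber integral of `Θ^*α`. -/
theorem isFiberIntegral_greenMap (hS : IsSignedHalfLine S ε) {k : ℕ} (α : FormC I N (k + 1)) :
    IsFiberIntegral I S (actionPullback I α.1) (ε • greenMap hS k α : Form I N k) := by
  intro p v
  let L : (E [⋀^Fin k]→L[ℝ] ℝ) →L[ℝ] ℝ := ContinuousAlternatingMap.apply ℝ E ℝ v
  have hI := (integrable_flowContract α p).integrableOn (s := S)
  refine ⟨L.integrable_comp hI, ?_⟩
  -- the sign of `greenMap` cancels the one in front
  have hε : ε * ε = 1 := by rcases hS with ⟨-, rfl⟩ | ⟨-, rfl⟩ <;> norm_num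
  have h1 : ((ε • greenMap hS k α : Form I N k) p v : ℝ) =
      ε * (ε * L (∫ t in S, flowContract I α.1 t p)) := rfl
  rw [h1, ← mul_assoc, hε, one_mul, ← L.integral_comp_comm hI]
  rfl

/-- The term `G dα` of the homotopy equation as an integral of the exterior derivative of the local
form, taken within `ℝ × u` as in the homotopy formula. -/
theorem chartRep_greenMap_extDC (hS : IsSignedHalfLine S ε) {k : ℕ} (α : FormC I N k)
    (x₀ : N) {u : Set E} (hur : u ⊆ range I) (hun : u ∈ 𝓝[range I] (extChartAt I x₀ x₀)) {R : ℝ}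
    (hR : ∀ t : ℝ, R < |t| → t +ᵥ (extChartAt I x₀).symm (extChartAt I x₀ x₀) ∉ support I α.1) :
    chartRep I (greenMap hS k (extDC I N k α)) x₀ (extChartAt I x₀ x₀) =
      ∫ t in (-ε * (|R| + 1))..0, contractTime E k (extDerivWithin
        (pullbackWithin (flowBox I x₀) (univ ×ˢ range I) α.1) (univ ×ˢ u)
          (t, extChartAt I x₀ x₀)) := by
  have hy := mem_extChartAt_target (I := I) x₀
  refine (chartRep_greenFun hS (extDC I N k α).1 x₀ hy
    fun t ht h ↦ hR t ht (support_extD α.1 h)).trans ?_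
  congr 1
  funext t
  have hu : (univ ×ˢ u : Set (ℝ × E)) =ᶠ[𝓝 (t, extChartAt I x₀ x₀)] univ ×ˢ range I := by
    rw [← nhdsWithin_eq_iff_eventuallyEq, nhdsWithin_prod_eq, nhdsWithin_prod_eq]
    congr 1
    exact le_antisymm (nhdsWithin_mono _ hur) (nhdsWithin_le_of_mem hun)
  congr 1
  rw [extDerivWithin, fderivWithin_congr_set hu]
  exact (extDerivWithin_pullbackWithin_flowBox α.1 x₀ (z := (t, extChartAt I x₀ x₀)) hy).symm

/-- The homotopy equation `dG + Gd = j` in positive degrees: the boundary term at `-ε (|R| + 1)`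
vanishes, and the one at `0` is `α`. -/
theorem extD_greenMap_add (hS : IsSignedHalfLine S ε) {k : ℕ} (α : FormC I N (k + 1)) :
    extD I N k (greenMap hS k α) + greenMap hS (k + 1) (extDC I N (k + 1) α) = α.1 := by
  refine ContMDiffSection.ext fun x₀ ↦ FormAt.eq_of_chartRep_eq ?_
  obtain ⟨R, u, huc, hud, hy₀, hur, hun, hut, hR⟩ := exists_convex_mem_nhdsWithin (I := I) α.2 x₀
  have h1 : chartRep I (extDerivAt I (greenMap hS k α)) x₀ (extChartAt I x₀ x₀) =
      extDerivWithin (fun y ↦ ∫ t in (-ε * (|R| + 1))..0, contractTime E k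
        (pullbackWithin (flowBox I x₀) (univ ×ˢ range I) α.1 (t, y))) u (extChartAt I x₀ x₀) := by
    have hu : u =ᶠ[𝓝 (extChartAt I x₀ x₀)] range I := nhdsWithin_eq_iff_eventuallyEq.1
      (le_antisymm (nhdsWithin_mono _ hur) (nhdsWithin_le_of_mem hun))
    rw [chartRep_extDerivAt _ x₀ (hut hy₀), extDerivWithin, ← fderivWithin_congr_set hu]
    refine Filter.EventuallyEq.extDerivWithin_eq_of_mem ?_ hy₀
    filter_upwards [self_mem_nhdsWithin] with y hy
    exact chartRep_greenFun hS α.1 x₀ (hut hy) (hR y hy)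
  have h2 := extDerivWithin_integral_contractTime huc hud
    (contDiffOn_pullbackWithin_flowBox α.1 x₀ hur hut) (-ε * (|R| + 1)) 0 hy₀
  rw [← h1, ← chartRep_greenMap_extDC hS α x₀ hur hun (hR _ hy₀),
    pullbackWithin_flowBox_eq_zero α.1 x₀ (hR _ hy₀ _ (hS.lt_abs R)), map_zero, sub_zero,
    restrictSpace_pullbackWithin_flowBox_zero (α.1 : ∀ p : N, FormAt I (k + 1) p) x₀ (hut hy₀)]
    at h2
  rw [← h2, chartRep_add]
  rfl

/-- The homotopy equation in degree zero, where it reads `Gd = j`. -/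
theorem greenMap_extDC_zero (hS : IsSignedHalfLine S ε) (α : FormC I N 0) :
    greenMap hS 0 (extDC I N 0 α) = α.1 := by
  refine ContMDiffSection.ext fun x₀ ↦ FormAt.eq_of_chartRep_eq ?_
  obtain ⟨R, u, -, hud, hy₀, hur, hun, hut, hR⟩ := exists_convex_mem_nhdsWithin (I := I) α.2 x₀
  rw [chartRep_greenMap_extDC hS α x₀ hur hun (hR _ hy₀),
    integral_contractTime_extDerivWithin_zero hud
      (contDiffOn_pullbackWithin_flowBox α.1 x₀ hur hut) _ _ hy₀,
    pullbackWithin_flowBox_eq_zero α.1 x₀ (hR _ hy₀ _ (hS.lt_abs R)), map_zero, sub_zero,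
    restrictSpace_pullbackWithin_flowBox_zero (α.1 : ∀ p : N, FormAt I 0 p) x₀ (hut hy₀)]

/-- The support of `ε ∫_S Θ^*α` lies in the orbit of the support of `α` under `-S`. -/
theorem support_greenMap_subset [T2Space N] (hS : IsSignedHalfLine S ε) (hSc : IsClosed S) {k : ℕ}
    (α : FormC I N (k + 1)) :
    support I (greenMap hS k α) ⊆ {q : N | ∃ p ∈ support I α.1, ∃ s ∈ -S, q = s +ᵥ p} := by
  refine closure_minimal (fun q hq ↦ ?_) (isClosed_image_vadd_of_isCompact α.2 hSc.neg)
  by_contra hne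
  have h0 : ∀ t ∈ S, flowContract I α.1 t q = 0 := fun t ht ↦
    flowContract_eq_zero <| eq_zero_of_notMem_support α.1 fun hmem ↦
      hne ⟨t +ᵥ q, hmem, -t, by simpa using ht, (neg_vadd_vadd t q).symm⟩
  have hm : MeasurableSet S := hSc.measurableSet
  apply hq
  rw [greenMap_apply, greenFun, setIntegral_congr_fun hm h0]
  simp only [integral_zero, smul_zero]
  rfl

end Green

/-! ### Green's homotopies as elements of the internal hom complex -/

section Cochains

open CategoryTheory CochainComplex.HomComplex

universe u v w

variable {E : Type u} [NormedAddCommGroup E] [NormedSpace ℝ E]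
  {H : Type w} [TopologicalSpace H] {I : ModelWithCorners ℝ E H}
  {N : Type v} [TopologicalSpace N] [ChartedSpace H N] [IsManifold I ∞ N]

theorem deRham_d_ofNat (k : ℕ) : (deRham I N).d (Int.ofNat k) (Int.ofNat (k + 1)) =
    ModuleCat.ofHom (extD I N k) :=
  CochainComplex.of_d (deRhamX I N) (deRhamD I N) (j := Int.ofNat k)

theorem deRhamC_d_ofNat (k : ℕ) : (deRhamC I N).d (Int.ofNat k) (Int.ofNat (k + 1)) =
    ModuleCat.ofHom (extDC I N k) :=
  CochainComplex.of_d (deRhamCX I N) (deRhamCD I N) (j := Int.ofNat k)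

variable [AddAction ℝ N]
  [ContMDiffVAdd 𝓘(ℝ, ℝ) I ∞ ℝ N] [LocallyCompactSpace N] [ProperVAdd ℝ N]
  {S : Set ℝ} {ε : ℝ}

/-- The components of `greenCochain`; they are zero unless the target has degree at least zero. -/
def greenX (hS : IsSignedHalfLine S ε) : ∀ p q : ℤ, p + (-1) = q → (deRhamCX I N p ⟶ deRhamX I N q)
  | Int.ofNat (k + 1), Int.ofNat m, h => by
      obtain rfl : m = k := by simp only [Int.ofNat_eq_natCast] at h; omega
      exact ModuleCat.ofHom (greenMap hS m)
  | Int.ofNat 0, _, _ => 0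
  | Int.ofNat (_ + 1), Int.negSucc _, _ => 0
  | Int.negSucc _, _, _ => 0

variable (I N) in
/-- The maps `ε ∫_S Θ^*` as an element of degree `-1` of the internal hom complex. -/
def greenCochain (hS : IsSignedHalfLine S ε) : Cochain (deRhamC I N) (deRham I N) (-1) :=
  Cochain.mk (greenX hS)

theorem greenCochain_v (hS : IsSignedHalfLine S ε) (k : ℕ)
    (h : Int.ofNat (k + 1) + (-1) = Int.ofNat k) :
    (greenCochain I N hS).v (Int.ofNat (k + 1)) (Int.ofNat k) h =
      ModuleCat.ofHom (greenMap hS k) := rfl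

theorem component_greenCochain (hS : IsSignedHalfLine S ε) (k : ℕ) :
    component I (greenCochain I N hS) k = greenMap hS k := by
  rw [component, greenCochain_v]
  rfl

theorem δ_greenCochain (hS : IsSignedHalfLine S ε) :
    δ (-1) 0 (greenCochain I N hS) = Cochain.ofHom (incl I N) := by
  refine Cochain.ext₀ _ _ fun p ↦ ?_
  rw [Cochain.ofHom_v]
  rcases p with (_ | k) | k
  · rw [δ_v (-1) 0 (by norm_num) _ _ _ _ (Int.negSucc 0) (Int.ofNat 1) rfl rfl,
      deRhamC_d_ofNat 0]
    have h0 : (greenCochain I N hS).v (Int.ofNat 0) (Int.negSucc 0) rfl = 0 := rfl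
    rw [h0, Limits.zero_comp, zero_add, Int.negOnePow_zero, one_smul, greenCochain_v]
    exact ModuleCat.hom_ext (LinearMap.ext fun α ↦ greenMap_extDC_zero hS α)
  · rw [δ_v (-1) 0 (by norm_num) _ _ _ _ (Int.ofNat k) (Int.ofNat (k + 2)) (by simp) rfl,
      deRhamC_d_ofNat (k + 1), deRham_d_ofNat k,
      Int.negOnePow_zero, one_smul, greenCochain_v, greenCochain_v]
    exact ModuleCat.hom_ext (LinearMap.ext fun α ↦ extD_greenMap_add hS α)
  · exact ModuleCat.hom_ext (LinearMap.ext fun α ↦ Subsingleton.elim (α := PUnit) _ _)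

end Cochains

end GreenHomotopy

end

theorem mainTheorem5 {E : Type*} [NormedAddCommGroup E] [NormedSpace ℝ E] [FiniteDimensional ℝ E]
    {H : Type*} [TopologicalSpace H] (I : ModelWithCorners ℝ E H)
    {N : Type*} [TopologicalSpace N] [ChartedSpace H N] [IsManifold I ∞ N] [T2Space N]
    [AddAction ℝ N] [ContMDiffVAdd 𝓘(ℝ, ℝ) I ∞ ℝ N] [ProperVAdd ℝ N] :
    (∃ G : CochainComplex.HomComplex.Cochain
        (GreenHomotopy.deRhamC I N) (GreenHomotopy.deRham I N) (-1),
      GreenHomotopy.IsForwardIntegral I G ∧ GreenHomotopy.IsForwardGreenHomotopy I G) ∧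
    (∃ G : CochainComplex.HomComplex.Cochain
        (GreenHomotopy.deRhamC I N) (GreenHomotopy.deRham I N) (-1),
      GreenHomotopy.IsBackwardIntegral I G ∧ GreenHomotopy.IsBackwardGreenHomotopy I G) := by
  have : LocallyCompactSpace H := I.locallyCompactSpace
  have : LocallyCompactSpace N := ChartedSpace.locallyCompactSpace H N
  have hF : GreenHomotopy.IsSignedHalfLine (Set.Iic 0) 1 := Or.inl ⟨rfl, rfl⟩
  have hB : GreenHomotopy.IsSignedHalfLine (Set.Ici 0) (-1) := Or.inr ⟨rfl, rfl⟩
  refine ⟨⟨GreenHomotopy.greenCochain I N hF, fun k α ↦ ?_,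
      GreenHomotopy.δ_greenCochain hF, fun k α q hq ↦ ?_⟩,
    ⟨GreenHomotopy.greenCochain I N hB, fun k α ↦ ?_,
      GreenHomotopy.δ_greenCochain hB, fun k α q hq ↦ ?_⟩⟩
  · have h := GreenHomotopy.isFiberIntegral_greenMap hF α
    rw [one_smul] at h
    rw [GreenHomotopy.component_greenCochain]
    exact h
  · obtain ⟨p, hp, s, hs, h⟩ := GreenHomotopy.support_greenMap_subset hF isClosed_Iic α hq
    exact ⟨p, hp, s, by simpa using hs, h⟩
  · have h := GreenHomotopy.isFiberIntegral_greenMap hB α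
    have hneg : (-1 : ℝ) • GreenHomotopy.greenMap hB k α = -GreenHomotopy.greenMap hB k α := by
      refine ContMDiffSection.ext fun p ↦ ?_
      rw [ContMDiffSection.coe_smul, ContMDiffSection.coe_neg, Pi.smul_apply, Pi.neg_apply,
        neg_one_smul]
    rw [hneg] at h
    rw [GreenHomotopy.component_greenCochain]
    exact h
  · obtain ⟨p, hp, s, hs, h⟩ := GreenHomotopy.support_greenMap_subset hB isClosed_Ici α hq
    exact ⟨p, hp, s, by simpa using hs, h⟩
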